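/- Consider the problem $\min f_0(x)$ subject to $f_j(x)\le 0$, $j\in I=\{1,\dots,m\}$, $x\in\mathbb R^n$, where $f_0,f_1,\dots,f_m:\mathbb R^n\to\mathbb R$ are twice continuously differentiable; write $g_j=\nabla f_j$, $\|\cdot\|$ for the Euclidean norm, $\varphi(x)=\max\{0,f_j(x):j\in I\}$, $\bar f_j(x)=f_j(x)$ if $f_j(x)\le 0$ and $\bar f_j(x)=f_j(x)-\varphi(x)$ if $f_j(x)>0$, $I(x)=\{j\in I:\bar f_j(x)=0\}$, and $L(x,\lambda)=f_0(x)+\sum_{j\in I}\lambda_jf_j(x)$. A KKT pair is a pair $(x,\lambda)$ with $\nabla_xL(x,\lambda)=0$ and $f_j(x)\le0$, $\lambda_j\ge0$, $\lambda_jf_j(x)=0$ for all $j\in I$. **Algorithm.** Parameters: $\gamma,\eta,\varepsilon\in(0,1)$, $0<\theta<\sigma<1$, $0<\varrho<\sigma$, $\xi,\zeta>0$, $\alpha\in(0,\frac12)$, $\rho>1$, $\delta>2$, $\tau\in(2,3)$. The starting point $x^0\in\mathbb R^n$ and the symmetric positive definite matrix $B_0$ are arbitrary. At iteration $k$, let $\varphi_k=\varphi(x^k)$.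 1. Let $d_0^k$ be the solution of $\min_d\ g_0(x^k)^Td+\frac12d^TB_kd$ subject to $\bar f_j(x^k)+g_j(x^k)^Td\le0$, $j\in I$, and $\lambda^k$ a corresponding KKT multiplier vector. If $d_0^k=0$ and $\varphi_k=0$, stop. 2. Let $N_k$ be the matrix with columns $g_j(x^k)$, let $D^k=\mathrm{diag}(D^k_j)$ with $D_j^k=|\bar f_j(x^k)|\,(|\bar f_j(x^k)+g_j(x^k)^Td_0^k|+\|d_0^k\|)$, and let $V_k=\begin{pmatrix}B_k&N_k\\N_k^T&-D^k\end{pmatrix}$. Let $(d_1^k,h_1^k)$ solve $V_k\binom{d}{h}=\binom{0}{r}$ with $r_j=-(\|d_0^k\|^\tau+\varphi_k^\sigma)-(f_j(x^k+d_0^k)-f_j(x^k)-g_j(x^k)^Td_0^k)$, and put $d^k=d_0^k+d_1^k$. If $g_0(x^k)^Td_0^k\le\zeta\min\{-\|d_0^k\|^\delta,-\|d^k\|^\delta\}+\xi\varphi_k^\varrho$, go to 3, otherwise to 4. 3. Let $t_k$ be the first $t$ among $1,\frac12,\frac14,\dots$ with $t\ge\varepsilon$ such that $f_0(x^k+td^k)\le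 f_0(x^k)+\alpha t\,g_0(x^k)^Td_0^k+\rho(1-\alpha)t\varphi_k^\theta$, such that $f_j(x^k+td^k)\le\varphi_k-\alpha t(\|d_0^k\|^\tau+\varphi_k^\sigma)$ for all $j$ with $f_j(x^k)>0$, and such that $f_j(x^k+td^k)\le0$ for all $j$ with $f_j(x^k)\le0$; then go to 6. If there is no such $t$, go to 4. 4. Let $(\tilde d^k,\tilde h^k)$ solve $V_k\binom dh=\binom{0}{r}$ with $r_j=-(\|d_0^k\|+\varphi_k^\sigma)$ for all $j$. Put $\beta_k=\min\Big\{1,\frac{(\theta-1)g_0(x^k)^Td_0^k+\varphi_k^\theta}{g_0(x^k)^T\tilde d^k-g_0(x^k)^Td_0^k}\Big\}$ if $g_0(x^k)^T\tilde d^k>g_0(x^k)^Td_0^k$ and $\beta_k=1$ otherwise, and $q^k=(1-\beta_k)d_0^k+\beta_k\tilde d^k$. 5. Let $t_k$ be the first $t$ among $1,\eta,\eta^2,\dots$ such that $f_0(x^k+tq^k)\le f_0(x^k)+\gamma t\,g_0(x^k)^Tq^k+\rho(1-\gamma)t\varphi_k^\theta$, such that $f_j(x^k+tq^k)\le\varphi_k-\gamma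 t\beta_k(\|d_0^k\|+\varphi_k^\sigma)$ for all $j$ with $f_j(x^k)>0$, and such that $f_j(x^k+tq^k)\le0$ for all $j$ with $f_j(x^k)\le0$. Redefine $d^k=q^k$. 6. Put $x^{k+1}=x^k+t_kd^k$, choose any symmetric positive definite matrix $B_{k+1}$, and go to 1 with $k+1$ in place of $k$. **Theorem.** Suppose that for every $x\in\mathbb R^n$ the vectors $g_j(x)$, $j\in I(x)$, are linearly independent. Let $\{x^k\}$ be an infinite sequence generated by the algorithm, and suppose that there are constants $a,b>0$ with $a\|d\|^2\le d^TB_kd\le b\|d\|^2$ for all $d\in\mathbb R^n$ and all $k$. Suppose that $\{x^k\}$ is bounded and has an accumulation point $x^*$ such that every KKT pair of the form $(x^*,\lambda^*)$ satisfies (a) $d^T\nabla^2_{xx}L(x^*,\lambda^*)d>0$ for all $d\ne0$ with $g_j(x^*)^Td=0$ for all $j$ with $\lambda_j^*>0$ (strong second-order sufficient condition), and (b) $\|(\nabla^2_{xx}L(x^*,\lambda^*)-B_k)d_0^k\|=o(\|d_0^k\|)$ as $k\to\infty$. Then $x^*$ is a KKT point (there is $\lambda^*$ such that $(x^*,\lambda^*)$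 is a KKT pair), $x^k\to x^*$, and $\|x^{k+1}-x^*\|=o(\|x^k-x^*\|)$ as $k\to\infty$, i.e. the convergence is superlinear. Strict complementarity is not assumed. -/

import Mathlib

open Filter Topology Asymptotics
open scoped InnerProductSpace Gradient

noncomputable section

namespace NCP

/-- The space `ℝⁿ` with its Euclidean norm. -/
abbrev E (n : ℕ) : Type := EuclideanSpace ℝ (Fin n)

/-- The data of the problem `min f₀(x)` subject to `f_j(x) ≤ 0`, `j = 1, …, m`, on `ℝⁿ`. -/
structure Problem (n m : ℕ) where
  f₀ : E n → ℝ
  f : Fin m → E n → ℝ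

/-- The parameters of the algorithm. -/
structure Params where
  γ : ℝ
  η : ℝ
  ε : ℝ
  θ : ℝ
  σ : ℝ
  ϱ : ℝ
  ξ : ℝ
  ζ : ℝ
  α : ℝ
  ρ : ℝ
  δ : ℝ
  τ : ℝ

/-- The admissible ranges of the parameters. -/
structure Params.Admissible (p : Params) : Prop where
  γ_mem : p.γ ∈ Set.Ioo (0 : ℝ) 1
  η_mem : p.η ∈ Set.Ioo (0 : ℝ) 1
  ε_mem : p.ε ∈ Set.Ioo (0 : ℝ) 1
  θ_pos : 0 < p.θ
  θ_lt : p.θ < p.σ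
  σ_lt : p.σ < 1
  ϱ_pos : 0 < p.ϱ
  ϱ_lt : p.ϱ < p.σ
  ξ_pos : 0 < p.ξ
  ζ_pos : 0 < p.ζ
  α_mem : p.α ∈ Set.Ioo (0 : ℝ) (1 / 2)
  ρ_gt : 1 < p.ρ
  δ_gt : 2 < p.δ
  τ_mem : p.τ ∈ Set.Ioo (2 : ℝ) 3

variable {n m : ℕ}

/-- The action `d ↦ B d` of a matrix on `ℝⁿ`. -/
def act (B : Matrix (Fin n) (Fin n) ℝ) (d : E n) : E n :=
  Matrix.toEuclideanLin B d

/-- The Hessian `∇²h(x)`, as the derivative of the gradient field of `h`. -/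
def hess (h : E n → ℝ) (x : E n) : E n →L[ℝ] E n :=
  fderiv ℝ (fun y => ∇ h y) x

namespace Problem

variable (P : Problem n m)

/-- The gradient `g₀(x) = ∇f₀(x)`. -/
def g₀ (x : E n) : E n := ∇ P.f₀ x

/-- The gradient `g_j(x) = ∇f_j(x)`. -/
def g (j : Fin m) (x : E n) : E n := ∇ (P.f j) x

/-- `φ(x) = max {0, f_j(x), j = 1, …, m}`. -/
def phi (x : E n) : ℝ := Finset.univ.fold max 0 (fun j => P.f j x)

/-- `f̄_j(x)`: equal to `f_j(x)` if `f_j(x) ≤ 0`, and to `f_j(x) - φ(x)` if `f_j(x) > 0`. -/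
def fbar (j : Fin m) (x : E n) : ℝ :=
  if P.f j x ≤ 0 then P.f j x else P.f j x - P.phi x

/-- The index set `I(x) = {j : f̄_j(x) = 0}`. -/
def activeSet (x : E n) : Set (Fin m) := {j | P.fbar j x = 0}

/-- The Lagrangian `L(x, lam) = f₀(x) + ∑ⱼ lam_j f_j(x)`. -/
def lagrangian (lam : Fin m → ℝ) (x : E n) : ℝ :=
  P.f₀ x + ∑ j, lam j * P.f j x

/-- `(x, lam)` is a KKT pair of the problem. -/
structure IsKKTPair (x : E n) (lam : Fin m → ℝ) : Prop where
  stationary : P.g₀ x + ∑ j, lam j • P.g j x = 0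
  feasible : ∀ j, P.f j x ≤ 0
  nonneg : ∀ j, 0 ≤ lam j
  complementary : ∀ j, lam j * P.f j x = 0

/-- The gradients `g_j(x)`, `j ∈ I(x)`, are linearly independent, at every `x ∈ ℝⁿ`. -/
def GradientsIndependent : Prop :=
  ∀ x : E n, LinearIndependent ℝ (fun j : P.activeSet x => P.g j x)

/-- The strong second-order sufficient condition at `(x, lam)`: the Hessian of the Lagrangian is
positive on every nonzero `d` orthogonal to all `g_j(x)` with `lam_j > 0`. -/
def SSOSC (x : E n) (lam : Fin m → ℝ) : Prop :=
  ∀ d : E n, d ≠ 0 → (∀ j, 0 < lam j → ⟪P.g j x, d⟫_ℝ = 0) →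
    0 < ⟪d, hess (P.lagrangian lam) x d⟫_ℝ

/-- Feasibility of `d` for the quadratic subproblem at `x`. -/
def QPFeasible (x d : E n) : Prop :=
  ∀ j, P.fbar j x + ⟪P.g j x, d⟫_ℝ ≤ 0

/-- The objective function `g₀(x)ᵀd + ½ dᵀBd` of the quadratic subproblem. -/
def qpObj (x : E n) (B : Matrix (Fin n) (Fin n) ℝ) (d : E n) : ℝ :=
  ⟪P.g₀ x, d⟫_ℝ + 1 / 2 * ⟪d, act B d⟫_ℝ

/-- `d` is an optimal solution of the quadratic subproblem at `x` with matrix `B`. -/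
def IsQPSolution (x : E n) (B : Matrix (Fin n) (Fin n) ℝ) (d : E n) : Prop :=
  P.QPFeasible x d ∧ ∀ d', P.QPFeasible x d' → P.qpObj x B d ≤ P.qpObj x B d'

/-- `lam` is a KKT multiplier vector of the quadratic subproblem at its solution `d`. -/
structure IsQPMultiplier (x : E n) (B : Matrix (Fin n) (Fin n) ℝ) (d : E n)
    (lam : Fin m → ℝ) : Prop where
  stationary : P.g₀ x + act B d + ∑ j, lam j • P.g j x = 0
  nonneg : ∀ j, 0 ≤ lam j
  complementary : ∀ j, lam j * (P.fbar j x + ⟪P.g j x, d⟫_ℝ) = 0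

/-- The diagonal entry `D_j = |f̄_j(x)| (|f̄_j(x) + g_j(x)ᵀd₀| + ‖d₀‖)`. -/
def diag (x d₀ : E n) (j : Fin m) : ℝ :=
  |P.fbar j x| * (|P.fbar j x + ⟪P.g j x, d₀⟫_ℝ| + ‖d₀‖)

/-- `(d, h)` solves the linear system with the block matrix `[[B, N], [Nᵀ, -D]]`, where `N` has the
columns `g_j(x)` and `D` is the diagonal matrix above, and with right-hand side `(0, r)`. -/
def SolvesSLE (x : E n) (B : Matrix (Fin n) (Fin n) ℝ) (d₀ : E n) (r : Fin m → ℝ)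
    (d : E n) (h : Fin m → ℝ) : Prop :=
  act B d + ∑ j, h j • P.g j x = 0 ∧
    ∀ j, ⟪P.g j x, d⟫_ℝ - P.diag x d₀ j * h j = r j

/-- Right-hand side of the system for the feasible direction: `-(‖d₀‖ + φ^σ)`. -/
def rhsTilde (p : Params) (x d₀ : E n) : Fin m → ℝ :=
  fun _ => -(‖d₀‖ + P.phi x ^ p.σ)

/-- Right-hand side of the system for the correction direction:
`-(‖d₀‖^τ + φ^σ) - (f_j(x + d₀) - f_j(x) - g_j(x)ᵀd₀)`. -/
def rhsCorr (p : Params) (x d₀ : E n) : Fin m → ℝ :=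
  fun j => -(‖d₀‖ ^ p.τ + P.phi x ^ p.σ) - (P.f j (x + d₀) - P.f j x - ⟪P.g j x, d₀⟫_ℝ)

/-- The weight `β` of the convex combination of `d₀` and `dt`. -/
def beta (p : Params) (x d₀ dt : E n) : ℝ :=
  if ⟪P.g₀ x, d₀⟫_ℝ < ⟪P.g₀ x, dt⟫_ℝ then
    min 1 (((p.θ - 1) * ⟪P.g₀ x, d₀⟫_ℝ + P.phi x ^ p.θ) /
      (⟪P.g₀ x, dt⟫_ℝ - ⟪P.g₀ x, d₀⟫_ℝ))
  else 1

/-- The direction `q = (1 - β) d₀ + β dt`. -/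
def q (p : Params) (x d₀ dt : E n) : E n :=
  (1 - P.beta p x d₀ dt) • d₀ + P.beta p x d₀ dt • dt

/-- The test that `d = d₀ + d₁` has to pass before the first line search is tried. -/
def DirectionTest (p : Params) (x d₀ d : E n) : Prop :=
  ⟪P.g₀ x, d₀⟫_ℝ ≤ p.ζ * min (-‖d₀‖ ^ p.δ) (-‖d‖ ^ p.δ) + p.ξ * P.phi x ^ p.ϱ

/-- The acceptance test of the first line search, along `d = d₀ + d₁`, for the step length `t`. -/
structure AcceptI (p : Params) (x d₀ d : E n) (t : ℝ) : Prop where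
  objective : P.f₀ (x + t • d) ≤
    P.f₀ x + p.α * t * ⟪P.g₀ x, d₀⟫_ℝ + p.ρ * (1 - p.α) * t * P.phi x ^ p.θ
  violated : ∀ j, 0 < P.f j x →
    P.f j (x + t • d) ≤ P.phi x - p.α * t * (‖d₀‖ ^ p.τ + P.phi x ^ p.σ)
  satisfied : ∀ j, P.f j x ≤ 0 → P.f j (x + t • d) ≤ 0

/-- The acceptance test of the second line search, along `q`, for the step length `t`. -/
structure AcceptII (p : Params) (x d₀ dt : E n) (t : ℝ) : Prop where
  objective : P.f₀ (x + t • P.q p x d₀ dt) ≤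
    P.f₀ x + p.γ * t * ⟪P.g₀ x, P.q p x d₀ dt⟫_ℝ + p.ρ * (1 - p.γ) * t * P.phi x ^ p.θ
  violated : ∀ j, 0 < P.f j x →
    P.f j (x + t • P.q p x d₀ dt) ≤
      P.phi x - p.γ * t * P.beta p x d₀ dt * (‖d₀‖ + P.phi x ^ p.σ)
  satisfied : ∀ j, P.f j x ≤ 0 → P.f j (x + t • P.q p x d₀ dt) ≤ 0

/-- The first line search, over `t = 1, 1/2, 1/4, …` as long as `t ≥ ε`, accepts a step length. -/
def SearchISucceeds (p : Params) (x d₀ d : E n) : Prop :=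
  ∃ i : ℕ, p.ε ≤ (1 / 2 : ℝ) ^ i ∧ P.AcceptI p x d₀ d ((1 / 2) ^ i)

/-- Update of cycle I: the direction test holds, and `x'` is obtained from `x` along `d = d₀ + d₁`
with the first accepted step length among `1, 1/2, 1/4, …`, which is at least `ε`. -/
def CycleI (p : Params) (x d₀ d₁ x' : E n) : Prop :=
  P.DirectionTest p x d₀ (d₀ + d₁) ∧
    ∃ i : ℕ, p.ε ≤ (1 / 2 : ℝ) ^ i ∧ P.AcceptI p x d₀ (d₀ + d₁) ((1 / 2) ^ i) ∧
      (∀ l < i, ¬ P.AcceptI p x d₀ (d₀ + d₁) ((1 / 2) ^ l)) ∧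
      x' = x + ((1 / 2 : ℝ) ^ i) • (d₀ + d₁)

/-- Update of cycle II: the direction test or the first line search fails, and `x'` is obtained from
`x` along `q` with the first accepted step length among `1, η, η², …`. -/
def CycleII (p : Params) (x : E n) (B : Matrix (Fin n) (Fin n) ℝ) (d₀ d₁ x' : E n) : Prop :=
  ¬ (P.DirectionTest p x d₀ (d₀ + d₁) ∧ P.SearchISucceeds p x d₀ (d₀ + d₁)) ∧
    ∃ (dt : E n) (ht : Fin m → ℝ), P.SolvesSLE x B d₀ (P.rhsTilde p x d₀) dt ht ∧
      ∃ i : ℕ, P.AcceptII p x d₀ dt (p.η ^ i) ∧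
        (∀ l < i, ¬ P.AcceptII p x d₀ dt (p.η ^ l)) ∧
        x' = x + (p.η ^ i) • P.q p x d₀ dt

/-- An infinite run of the algorithm: the iterates `x k`, the symmetric positive definite matrices
`B k` (updated in an arbitrary way), the solutions `d₀ k` of the quadratic subproblems with their
multipliers `lam k`, and the correction directions `d₁ k`. The starting data `x 0` and `B 0` are
arbitrary. That the run is infinite means that the stopping test `(d₀ k, φ(x k)) = (0, 0)` is never
satisfied. -/
structure IsRun (p : Params) (x : ℕ → E n) (B : ℕ → Matrix (Fin n) (Fin n) ℝ)
    (d₀ : ℕ → E n) (lam : ℕ → Fin m → ℝ) (d₁ : ℕ → E n) : Prop where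
  posDef : ∀ k, (B k).PosDef
  qp : ∀ k, P.IsQPSolution (x k) (B k) (d₀ k)
  multiplier : ∀ k, P.IsQPMultiplier (x k) (B k) (d₀ k) (lam k)
  not_stopped : ∀ k, ¬ (d₀ k = 0 ∧ P.phi (x k) = 0)
  correction : ∀ k, ∃ h₁ : Fin m → ℝ,
    P.SolvesSLE (x k) (B k) (d₀ k) (P.rhsCorr p (x k) (d₀ k)) (d₁ k) h₁
  update : ∀ k, P.CycleI p (x k) (d₀ k) (d₁ k) (x (k + 1)) ∨
    P.CycleII p (x k) (B k) (d₀ k) (d₁ k) (x (k + 1))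

end Problem

/-- The matrices `B k` are uniformly positive definite (and uniformly bounded). -/
def UniformlyPosDef (B : ℕ → Matrix (Fin n) (Fin n) ℝ) : Prop :=
  ∃ a b : ℝ, 0 < a ∧ 0 < b ∧ ∀ (k : ℕ) (d : E n),
    a * ‖d‖ ^ 2 ≤ ⟪d, act (B k) d⟫_ℝ ∧ ⟪d, act (B k) d⟫_ℝ ≤ b * ‖d‖ ^ 2

end NCP

end

/-
Compactness and the linear independence of the active gradients bound the multipliers of the
quadratic subproblems and make the linear systems uniformly solvable, so that their solutions are
comparable to their right-hand sides. Hence every iteration lowers `φ` by at least `κ φ^σ` with a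
fixed `κ > 0`. Since `σ < 1`, this exhausts a positive `φ` in finitely many steps; from then on the
iterates are feasible and `f₀` decreases by at least `κ ‖d₀‖²` per step, which forces `d₀ → 0`.

Near `x*` the multipliers `λ` converge to the unique KKT multiplier `λ*`. Put `w = x - x* + d₀`.
Up to terms of second order, `(λ_j - λ*_j) ⟪g_j, w⟫` has a sign for every `j`, whether or not
strict complementarity holds. Testing the optimality conditions of the subproblem with `w` and
using the second-order condition together with (b) gives `w = o(‖x - x*‖ + ‖d₀‖)`. In particular
`‖x - x*‖ = O(‖d₀‖)` while the steps are `O(‖d₀‖) → 0`, so the iterates cannot leave a neighbourhood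
of `x*` and converge to it. The correction `d₁ = O(‖d₀‖²)` removes the second-order constraint
violation that causes the Maratos effect, so unit steps are accepted eventually, and then the new
error is `w + d₁ = o(‖x - x*‖)`.
-/

namespace NCP

open scoped NNReal

section Calculus

variable {F : Type*} [NormedAddCommGroup F] [InnerProductSpace ℝ F] [CompleteSpace F]

theorem contDiff_gradient {h : F → ℝ} {k : WithTop ℕ∞} (hh : ContDiff ℝ (k + 1) h) :
    ContDiff ℝ k (∇ h) :=
  (InnerProductSpace.toDual ℝ F).symm.toContinuousLinearEquiv.contDiff.comp
    (hh.fderiv_right le_rfl)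

theorem abs_sub_sub_inner_sub_quadratic_le {h : F → ℝ} (hh : Differentiable ℝ h)
    (T : F →L[ℝ] F) (x d : F) {C : ℝ}
    (hC : ∀ s ∈ Set.Ico (0 : ℝ) 1, ‖∇ h (x + s • d) - ∇ h x - T (s • d)‖ ≤ C) :
    |h (x + d) - h x - ⟪∇ h x, d⟫_ℝ - 1 / 2 * ⟪d, T d⟫_ℝ| ≤ C * ‖d‖ := by
  let ψ : ℝ → ℝ := fun s => h (x + s • d) - s * ⟪∇ h x, d⟫_ℝ - 1 / 2 * s ^ 2 * ⟪d, T d⟫_ℝ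
  have hder : ∀ s : ℝ, HasDerivAt ψ ⟪∇ h (x + s • d) - ∇ h x - T (s • d), d⟫_ℝ s := by
    intro s
    have hline : HasDerivAt (fun s : ℝ => x + s • d) d s := by
      simpa using ((hasDerivAt_id s).smul_const d).const_add x
    have hcomp := (hh (x + s • d)).hasGradientAt.hasFDerivAt.comp_hasDerivAt s hline
    have hψ := (hcomp.sub ((hasDerivAt_id s).mul_const ⟪∇ h x, d⟫_ℝ)).sub
      ((((hasDerivAt_id s).pow 2).const_mul (1 / 2 : ℝ)).mul_const ⟪d, T d⟫_ℝ)
    refine HasDerivAt.congr_deriv (f := ψ) hψ ?_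
    simp [inner_sub_left, inner_smul_left, real_inner_comm d (T d)]
  have hbound : ∀ s ∈ Set.Ico (0 : ℝ) 1,
      ‖⟪∇ h (x + s • d) - ∇ h x - T (s • d), d⟫_ℝ‖ ≤ C * ‖d‖ := fun s hs =>
    (norm_inner_le_norm _ _).trans (by gcongr; exact hC s hs)
  refine le_of_eq_of_le ?_ (norm_image_sub_le_of_norm_deriv_le_segment_01'
    (fun s _ => (hder s).hasDerivWithinAt) hbound)
  simp only [ψ, Real.norm_eq_abs, one_smul, zero_smul, add_zero]
  congr 1
  ring

variable {h : F → ℝ} {s : Set F} {L : ℝ≥0}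

theorem abs_sub_sub_inner_gradient_le (hh : Differentiable ℝ h) (hs : Convex ℝ s)
    (hL : LipschitzOnWith L (∇ h) s) {x d : F} (hx : x ∈ s) (hxd : x + d ∈ s) :
    |h (x + d) - h x - ⟪∇ h x, d⟫_ℝ| ≤ L * ‖d‖ ^ 2 := by
  have hgrad : ∀ t ∈ Set.Ico (0 : ℝ) 1, ‖∇ h (x + t • d) - ∇ h x - (0 : F →L[ℝ] F) (t • d)‖
      ≤ L * ‖d‖ := fun t ht => by
    have hlip := hL.norm_sub_le (hs.add_smul_mem hx hxd ⟨ht.1, ht.2.le⟩) hx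
    rw [add_sub_cancel_left, norm_smul, Real.norm_of_nonneg ht.1] at hlip
    simpa using hlip.trans (by gcongr; exact mul_le_of_le_one_left (norm_nonneg d) ht.2.le)
  simpa [sq, mul_assoc] using abs_sub_sub_inner_sub_quadratic_le hh 0 x d hgrad

theorem abs_sub_add_sub_inner_gradient_le (hh : Differentiable ℝ h) (hs : Convex ℝ s)
    (hL : LipschitzOnWith L (∇ h) s) {x d e : F} (hx : x ∈ s) (hd : x + d ∈ s)
    (he : x + (d + e) ∈ s) :
    |h (x + (d + e)) - h (x + d) - ⟪∇ h x, e⟫_ℝ| ≤ L * (‖d‖ + ‖e‖) * ‖e‖ := by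
  rw [← add_assoc] at he ⊢
  have htaylor := abs_sub_sub_inner_gradient_le hh hs hL hd he
  have hgrad : |⟪∇ h (x + d) - ∇ h x, e⟫_ℝ| ≤ L * ‖d‖ * ‖e‖ :=
    (abs_real_inner_le_norm _ _).trans
      (by gcongr; simpa using hL.norm_sub_le hd hx)
  rw [inner_sub_left] at hgrad
  calc _ = |(h (x + d + e) - h (x + d) - ⟪∇ h (x + d), e⟫_ℝ)
        + (⟪∇ h (x + d), e⟫_ℝ - ⟪∇ h x, e⟫_ℝ)| := by congr 1; ring
    _ ≤ L * ‖e‖ ^ 2 + L * ‖d‖ * ‖e‖ := (abs_add_le _ _).trans (add_le_add htaylor hgrad)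
    _ = L * (‖d‖ + ‖e‖) * ‖e‖ := by ring

variable {ι : Type*} {l : Filter ι} {x : ι → F} {z : F}

theorem gradient_sub_isLittleO {y : ι → F} (hh : ContDiff ℝ 2 h)
    (hx : Tendsto x l (𝓝 z)) (hy : Tendsto y l (𝓝 z)) :
    (fun k => ∇ h (y k) - ∇ h (x k) - fderiv ℝ (∇ h) z (y k - x k))
      =o[l] fun k => y k - x k := by
  have hstrict : HasStrictFDerivAt (∇ h) (fderiv ℝ (∇ h) z) z :=
    (contDiff_gradient (k := 1) hh).contDiffAt.hasStrictFDerivAt one_ne_zero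
  exact hstrict.isLittleO.comp_tendsto (hy.prodMk_nhds hx)

theorem taylor_two_isLittleO {d : ι → F} (hh : ContDiff ℝ 2 h)
    (hx : Tendsto x l (𝓝 z)) (hd : Tendsto d l (𝓝 0)) :
    (fun k => h (x k + d k) - h (x k) - ⟪∇ h (x k), d k⟫_ℝ
      - 1 / 2 * ⟪d k, fderiv ℝ (∇ h) z (d k)⟫_ℝ) =o[l] fun k => ‖d k‖ ^ 2 := by
  have hstrict : HasStrictFDerivAt (∇ h) (fderiv ℝ (∇ h) z) z :=
    (contDiff_gradient (k := 1) hh).contDiffAt.hasStrictFDerivAt one_ne_zero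
  rw [isLittleO_iff]
  intro c hc
  obtain ⟨r, hr, hball⟩ := Metric.eventually_nhds_iff_ball.1 (hstrict.isLittleO.def hc)
  filter_upwards [hx (Metric.ball_mem_nhds z (half_pos hr)),
    hd (Metric.ball_mem_nhds 0 (half_pos hr))] with k hxk hdk
  have hXk : ‖x k - z‖ < r / 2 := by simpa [dist_eq_norm] using hxk
  have hDk : ‖d k‖ < r / 2 := by simpa using hdk
  have hgrad : ∀ s ∈ Set.Ico (0 : ℝ) 1,
      ‖∇ h (x k + s • d k) - ∇ h (x k) - fderiv ℝ (∇ h) z (s • d k)‖ ≤ c * ‖d k‖ := by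
    intro s hs
    have hsd : ‖s • d k‖ ≤ ‖d k‖ := by
      rw [norm_smul, Real.norm_of_nonneg hs.1]
      exact mul_le_of_le_one_left (norm_nonneg _) hs.2.le
    have hmem : (x k + s • d k, x k) ∈ Metric.ball (z, z) r := by
      rw [Metric.mem_ball, Prod.dist_eq, max_lt_iff, dist_eq_norm, dist_eq_norm, add_sub_right_comm]
      exact ⟨by linarith [norm_add_le (x k - z) (s • d k)], by linarith⟩
    have happrox := hball _ hmem
    simp only [add_sub_cancel_left] at happrox
    exact happrox.trans (by gcongr)
  refine (abs_sub_sub_inner_sub_quadratic_le (hh.differentiable two_ne_zero) _ _ _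
    hgrad).trans_eq ?_
  rw [norm_pow, norm_norm]
  ring

theorem eventually_lipschitzOnWith_gradient [ProperSpace F] (hh : ContDiff ℝ 2 h)
    (hx : Bornology.IsBounded (Set.range x)) (r : ℝ) :
    ∀ᶠ L : ℝ≥0 in atTop, ∀ k, LipschitzOnWith L (∇ h) (Metric.closedBall (x k) r) := by
  obtain ⟨R, hR⟩ := hx.exists_norm_le
  obtain ⟨L₀, hL₀⟩ := (contDiff_gradient (k := 1) hh).contDiffOn.exists_lipschitzOnWith one_ne_zero
    (convex_closedBall (0 : F) (r + R)) (isCompact_closedBall _ _)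
  filter_upwards [eventually_ge_atTop L₀] with L hL k
  refine (hL₀.mono (Metric.closedBall_subset_closedBall' ?_)).weaken hL
  simpa using hR _ (Set.mem_range_self k)

end Calculus

section Compactness

variable {X : Type*} [TopologicalSpace X] {K : Set X}

theorem exists_pos_le_add_mul_of_isCompact (hK : IsCompact K) {a s : X → ℝ} (ha : Continuous a)
    (hs : Continuous s) (hs₀ : ∀ x, 0 ≤ s x) (hpos : ∀ x ∈ K, s x = 0 → 0 < a x) :
    ∃ c > 0, ∃ C, ∀ x ∈ K, c ≤ a x + C * s x := by
  let U : ℕ → Set X := fun N => {x | 1 / ((N : ℝ) + 1) < a x + N * s x}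
  have hU : Monotone U := by
    intro M N hMN x hx
    have hMN' : (M : ℝ) ≤ N := by exact_mod_cast hMN
    calc 1 / ((N : ℝ) + 1) ≤ 1 / ((M : ℝ) + 1) := by gcongr
      _ < a x + M * s x := hx
      _ ≤ a x + N * s x := by gcongr; exact hs₀ x
  have hcover : K ⊆ ⋃ N, U N := fun x hx => by
    rw [Set.mem_iUnion]
    suffices ∀ᶠ N : ℕ in atTop, 1 / ((N : ℝ) + 1) < a x + N * s x from this.exists
    obtain hsx | hsx := (hs₀ x).eq_or_lt
    · simpa [← hsx] using tendsto_one_div_add_atTop_nhds_zero_nat.eventually_lt_const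
        (hpos x hx hsx.symm)
    · have htop : Tendsto (fun N : ℕ => a x + N * s x) atTop atTop :=
        tendsto_atTop_add_const_left _ _ (tendsto_natCast_atTop_atTop.atTop_mul_const hsx)
      filter_upwards [htop.eventually_gt_atTop 1] with N hN
      exact (div_le_one (by positivity)).2 (by simp) |>.trans_lt hN
  obtain ⟨N, hN⟩ := hK.elim_directed_cover U
    (fun N => isOpen_lt continuous_const (by fun_prop)) hcover hU.directed_le
  exact ⟨1 / (N + 1), by positivity, N, fun x hx => (hN hx).le⟩

theorem exists_coercive_add_mul_sum_inner_sq {F ι : Type*} [NormedAddCommGroup F]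
    [InnerProductSpace ℝ F] [FiniteDimensional ℝ F] [Fintype ι] (T : F →L[ℝ] F) (v : ι → F)
    (hpos : ∀ d ≠ 0, (∀ j, ⟪v j, d⟫_ℝ = 0) → 0 < ⟪d, T d⟫_ℝ) :
    ∃ c > 0, ∃ C, ∀ d, c * ‖d‖ ^ 2 ≤ ⟪d, T d⟫_ℝ + C * ∑ j, ⟪v j, d⟫_ℝ ^ 2 := by
  have hsum : ∀ d, 0 ≤ ∑ j, ⟪v j, d⟫_ℝ ^ 2 := fun d => Finset.sum_nonneg fun j _ => sq_nonneg _
  obtain ⟨c, hc, C, hsphere⟩ := exists_pos_le_add_mul_of_isCompact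
    (isCompact_sphere (0 : F) 1) (a := fun d => ⟪d, T d⟫_ℝ) (s := fun d => ∑ j, ⟪v j, d⟫_ℝ ^ 2)
    (by fun_prop) (by fun_prop) hsum fun d hd hd₀ => by
      refine hpos d (ne_zero_of_mem_unit_sphere ⟨d, hd⟩) fun j => ?_
      simpa using (Finset.sum_eq_zero_iff_of_nonneg fun j _ => sq_nonneg _).1 hd₀ j
        (Finset.mem_univ j)
  refine ⟨c, hc, C, fun d => ?_⟩
  rcases eq_or_ne d 0 with rfl | hd
  · simp
  have hunit := hsphere (‖d‖⁻¹ • d) (by simp [norm_smul, hd])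
  simp only [map_smul, real_inner_smul_left, real_inner_smul_right, mul_pow,
    ← Finset.mul_sum] at hunit
  have hd' : 0 < ‖d‖ := norm_pos_iff.2 hd
  field_simp at hunit
  exact hunit

theorem exists_norm_le_of_linearIndependent {F ι : Type*} [NormedAddCommGroup F]
    [NormedSpace ℝ F] [Fintype ι] (hK : IsCompact K) {v : ι → X → F} {w : ι → X → ℝ}
    (hv : ∀ j, Continuous (v j)) (hw : ∀ j, Continuous (w j))
    (hli : ∀ x ∈ K, LinearIndependent ℝ fun j : {j | w j x = 0} => v j x) :
    ∃ C > 0, ∀ x ∈ K, ∀ h : ι → ℝ, ‖h‖ ≤ C * (‖∑ j, h j • v j x‖ + ∑ j, |w j x| * |h j|) := by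
  classical
  have hpos : ∀ y ∈ K ×ˢ Metric.sphere (0 : ι → ℝ) 1,
      0 < ‖∑ j, y.2 j • v j y.1‖ + ∑ j, |w j y.1| * |y.2 j| := by
    rintro ⟨x, h⟩ ⟨hx, hh⟩
    have hsum : 0 ≤ ∑ j, |w j x| * |h j| := by positivity
    refine (add_nonneg (norm_nonneg _) hsum).lt_of_ne' fun h₀ => ?_
    obtain ⟨hcomb, hinact⟩ := (add_eq_zero_iff_of_nonneg (norm_nonneg _) hsum).1 h₀
    have hsupp : ∀ j, w j x ≠ 0 → h j = 0 := fun j hj => by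
      simpa [hj] using (Finset.sum_eq_zero_iff_of_nonneg fun j _ => by positivity).1 hinact j
        (Finset.mem_univ j)
    have hact : ∑ j : {j | w j x = 0}, h j • v j x = 0 := by
      rw [Finset.sum_set_coe (f := fun j => h j • v j x), ← norm_eq_zero.1 hcomb]
      refine Finset.sum_subset (Finset.subset_univ _) fun j _ hj => ?_
      rw [hsupp j (by simpa using hj), zero_smul]
    refine ne_zero_of_mem_unit_sphere ⟨h, hh⟩ (funext fun j => ?_)
    by_cases hj : w j x = 0
    · exact Fintype.linearIndependent_iff.1 (hli x hx) (fun j => h j) hact ⟨j, hj⟩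
    · exact hsupp j hj
  obtain ⟨c, hc, hle⟩ := (hK.prod (isCompact_sphere (0 : ι → ℝ) 1)).exists_forall_le'
    (Continuous.continuousOn (by fun_prop)) hpos
  refine ⟨c⁻¹, inv_pos.2 hc, fun x hx h => ?_⟩
  rcases eq_or_ne h 0 with rfl | hh
  · simp
  have hh' : 0 < ‖h‖ := norm_pos_iff.2 hh
  have hunit := hle (x, ‖h‖⁻¹ • h) ⟨hx, by simp [norm_smul, hh]⟩
  simp only [Pi.smul_apply, smul_eq_mul, abs_mul, mul_left_comm _ |‖h‖⁻¹|, mul_smul,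
    ← Finset.smul_sum, ← Finset.mul_sum, norm_smul, Real.norm_eq_abs, ← mul_add] at hunit
  rw [abs_of_pos (inv_pos.2 hh'), le_inv_mul_iff₀ hh'] at hunit
  rwa [le_inv_mul_iff₀ hc, mul_comm]

end Compactness

section Sequences

theorem tendsto_zero_of_forall_le_sub {u v : ℕ → ℝ} (hv : ∀ k, 0 ≤ v k)
    (hbdd : BddBelow (Set.range u)) (h : ∀ k, u (k + 1) ≤ u k - v k) :
    Tendsto v atTop (𝓝 0) := by
  have hlim := tendsto_atTop_ciInf (antitone_nat_of_succ_le fun k => by linarith [h k, hv k]) hbdd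
  have hdiff := hlim.sub (hlim.comp (tendsto_add_atTop_nat 1))
  rw [sub_self] at hdiff
  exact squeeze_zero hv (fun k => by simpa using by linarith [h k]) hdiff

theorem not_forall_pos_of_le_sub_rpow {u : ℕ → ℝ} {c σ : ℝ} (hc : 0 < c) (hσ₀ : 0 < σ)
    (hσ₁ : σ < 1) (h : ∀ k, u (k + 1) ≤ u k - c * u k ^ σ) : ¬ ∀ k, 0 < u k := by
  intro hpos
  have hrpow : Tendsto (fun k => u k ^ σ) atTop (𝓝 0) := by
    have hmul := (tendsto_zero_of_forall_le_sub (v := fun k => c * u k ^ σ)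
      (fun k => mul_nonneg hc.le (Real.rpow_nonneg (hpos k).le _))
      ⟨0, Set.forall_mem_range.2 fun k => (hpos k).le⟩ h).const_mul c⁻¹
    simpa [inv_mul_cancel_left₀ hc.ne'] using hmul
  have hlim : Tendsto u atTop (𝓝 0) := by
    have hinv := hrpow.rpow_const (p := σ⁻¹) (Or.inr (inv_nonneg.2 hσ₀.le))
    simpa [← Real.rpow_mul (hpos _).le, mul_inv_cancel₀ hσ₀.ne', hσ₀.ne'] using hinv
  have hsmall := hlim.rpow_const (p := 1 - σ) (Or.inr (sub_pos.2 hσ₁).le)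
  rw [Real.zero_rpow (sub_pos.2 hσ₁).ne'] at hsmall
  obtain ⟨k, hk⟩ := (hsmall.eventually_lt_const hc).exists
  have hsplit : u k ^ (1 - σ) * u k ^ σ = u k := by
    rw [← Real.rpow_add (hpos k), sub_add_cancel, Real.rpow_one]
  have hlt := mul_lt_mul_of_pos_right hk (Real.rpow_pos_of_pos (hpos k) σ)
  linarith [h k, hpos (k + 1)]

theorem tendsto_of_mapClusterPt {X : Type*} [PseudoMetricSpace X] {x : ℕ → X} {z : X} {ε : ℕ → ℝ}
    (hε : Tendsto ε atTop (𝓝 0)) (hz : MapClusterPt z atTop x)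
    (hnear : ∀ᶠ k in atTop ⊓ comap x (𝓝 z), dist (x k) z ≤ ε k)
    (hstep : ∀ᶠ k in atTop, dist (x (k + 1)) (x k) ≤ ε k) : Tendsto x atTop (𝓝 z) := by
  rw [(atTop_basis.inf (Metric.nhds_basis_ball.comap x)).eventually_iff] at hnear
  obtain ⟨⟨K, r⟩, ⟨-, hr⟩, hKr⟩ := hnear
  replace hr : 0 < r := hr
  obtain ⟨K', hK'⟩ := eventually_atTop.1
    ((hstep.and (hε.eventually_lt_const (half_pos hr))).and (eventually_ge_atTop K))
  obtain ⟨k₀, hk₀r, hk₀⟩ := (hz.frequently (Metric.ball_mem_nhds z hr)).and_eventually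
    (eventually_ge_atTop K') |>.exists
  have hstay : ∀ k ≥ k₀, x k ∈ Metric.ball z r := by
    intro k hk
    induction k, hk using Nat.le_induction with
    | base => exact hk₀r
    | succ k hk ih =>
      obtain ⟨⟨hstepk, hεk⟩, hKk⟩ := hK' k (hk₀.trans hk)
      have hdist := hKr ⟨hKk, ih⟩
      exact (dist_triangle _ (x k) _).trans_lt (by linarith)
  refine tendsto_iff_dist_tendsto_zero.2 (squeeze_zero' (.of_forall fun _ => dist_nonneg) ?_ hε)
  filter_upwards [eventually_ge_atTop k₀] with k hk
  exact hKr ⟨(hK' k (hk₀.trans hk)).2, hstay k hk⟩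

theorem isBigO_of_add_isLittleO {ι F : Type*} [SeminormedAddCommGroup F] {l : Filter ι}
    {u d : ι → F} (h : (fun k => u k + d k) =o[l] fun k => ‖u k‖ + ‖d k‖) : u =O[l] d := by
  refine IsBigO.of_bound 3 ?_
  filter_upwards [h.def one_half_pos] with k hk
  rw [Real.norm_of_nonneg (by positivity)] at hk
  linarith [norm_le_add_norm_add (u k) (d k)]

theorem min_one_mul_le_pow_of_first {A : ℝ → Prop} {η T : ℝ} {i : ℕ} (hη : 0 < η)
    (hA : ∀ t, 0 < t → t ≤ T → A t) (hfirst : ∀ l < i, ¬A (η ^ l)) : min 1 (η * T) ≤ η ^ i := by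
  cases i with
  | zero => exact (min_le_left _ _).trans_eq (pow_zero η).symm
  | succ i =>
    refine (min_le_right _ _).trans ?_
    rw [pow_succ']
    have hlt : T < η ^ i := not_le.1 fun h => hfirst i i.lt_succ_self (hA _ (pow_pos hη i) h)
    gcongr

end Sequences

theorem eventually_forall_norm_le_of_isBounded_range {X F ι : Type*} [PseudoMetricSpace X]
    [ProperSpace X] [SeminormedAddCommGroup F] {f : X → F} (hf : Continuous f) {x : ι → X}
    (hx : Bornology.IsBounded (Set.range x)) : ∀ᶠ M : ℝ in atTop, ∀ k, ‖f (x k)‖ ≤ M := by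
  obtain ⟨C, hC⟩ := hx.isCompact_closure.exists_bound_of_continuousOn hf.continuousOn
  filter_upwards [eventually_ge_atTop C] with M hM k
  exact (hC _ (subset_closure (Set.mem_range_self k))).trans hM

theorem rpow_le_mul_rpow {t M θ σ : ℝ} (ht : 0 ≤ t) (htM : t ≤ M) (hM : 1 ≤ M) (hθ : 0 ≤ θ)
    (hθσ : θ ≤ σ) (hσθ : σ ≤ θ + 1) : t ^ σ ≤ M * t ^ θ :=
  calc t ^ σ = t ^ (σ - θ) * t ^ θ := by
        rw [← Real.rpow_add_of_nonneg ht (sub_nonneg.2 hθσ) hθ, sub_add_cancel]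
    _ ≤ M ^ (σ - θ) * t ^ θ := by gcongr
    _ ≤ M * t ^ θ := by
        gcongr
        exact Real.rpow_le_self_of_one_le hM (by linarith)

theorem norm_rpow_isLittleO {ι F : Type*} [SeminormedAddCommGroup F] {l : Filter ι} {d : ι → F}
    {s t : ℝ} (hd : Tendsto d l (𝓝 0)) (hs : 0 ≤ s) (hst : s < t) :
    (fun k => ‖d k‖ ^ t) =o[l] fun k => ‖d k‖ ^ s := by
  have hzero : (fun k => ‖d k‖ ^ (t - s)) =o[l] fun _ => (1 : ℝ) := by
    refine (isLittleO_one_iff ℝ).2 ?_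
    simpa [(sub_pos.2 hst).ne'] using hd.norm.rpow_const (Or.inr (sub_pos.2 hst).le)
  refine ((isBigO_refl (fun k => ‖d k‖ ^ s) l).mul_isLittleO hzero).congr (fun k => ?_) fun k => ?_
  · rw [← Real.rpow_add_of_nonneg (norm_nonneg _) hs (sub_pos.2 hst).le, add_sub_cancel]
  · rw [mul_one]

theorem inner_isLittleO {ι F : Type*} [NormedAddCommGroup F] [InnerProductSpace ℝ F]
    {l : Filter ι} {u v : ι → F} {f g : ι → ℝ} (hu : u =O[l] f) (hv : v =o[l] g) :
    (fun k => ⟪u k, v k⟫_ℝ) =o[l] fun k => f k * g k :=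
  (IsBigO.of_norm_le fun _ => norm_inner_le_norm _ _).trans_isLittleO
    (hu.norm_left.mul_isLittleO hv.norm_left)

theorem norm_apply_le_of_isPositive {F : Type*} [NormedAddCommGroup F] [InnerProductSpace ℝ F]
    {T : F →ₗ[ℝ] F} (hT : T.IsPositive) {b : ℝ} (hb : 0 < b)
    (h : ∀ d, ⟪d, T d⟫_ℝ ≤ b * ‖d‖ ^ 2) (d : F) : ‖T d‖ ≤ b * ‖d‖ := by
  have hnonneg := hT.inner_nonneg_right (d - b⁻¹ • T d)
  have hexpand : ⟪d - b⁻¹ • T d, T (d - b⁻¹ • T d)⟫_ℝ =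
      ⟪d, T d⟫_ℝ - 2 * b⁻¹ * ‖T d‖ ^ 2 + b⁻¹ ^ 2 * ⟪T d, T (T d)⟫_ℝ := by
    have hsymm : ⟪d, T (T d)⟫_ℝ = ‖T d‖ ^ 2 := by
      rw [← hT.isSymmetric d (T d), real_inner_self_eq_norm_sq]
    simp only [map_sub, map_smul, inner_sub_left, inner_sub_right, real_inner_smul_left,
      real_inner_smul_right, hsymm, real_inner_self_eq_norm_sq]
    ring
  have hTd : b⁻¹ ^ 2 * ⟪T d, T (T d)⟫_ℝ ≤ b⁻¹ * ‖T d‖ ^ 2 := by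
    calc _ ≤ b⁻¹ ^ 2 * (b * ‖T d‖ ^ 2) := by gcongr; exact h _
      _ = b⁻¹ * ‖T d‖ ^ 2 := by field_simp
  have hsq : b⁻¹ * ‖T d‖ ^ 2 ≤ b * ‖d‖ ^ 2 := by linarith [h d]
  rw [inv_mul_le_iff₀ hb] at hsq
  exact le_of_sq_le_sq (by linarith) (by positivity)

noncomputable section

variable {n m : ℕ}

namespace Problem

section Quantities

variable (P : Problem n m) (j : Fin m) (x : E n)

theorem phi_nonneg : 0 ≤ P.phi x :=
  ((Finset.fold_max_le (P.phi x)).1 le_rfl).1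

theorem le_phi : P.f j x ≤ P.phi x :=
  ((Finset.fold_max_le (P.phi x)).1 le_rfl).2 j (Finset.mem_univ j)

theorem fbar_nonpos : P.fbar j x ≤ 0 := by
  unfold fbar
  split_ifs with h
  · exact h
  · exact sub_nonpos.2 (P.le_phi j x)

theorem abs_fbar : |P.fbar j x| = -P.fbar j x :=
  abs_of_nonpos (P.fbar_nonpos j x)

variable {P j x}

theorem phi_eq_zero_iff : P.phi x = 0 ↔ ∀ j, P.f j x ≤ 0 :=
  ⟨fun h j => h ▸ P.le_phi j x, fun h =>
    ((Finset.fold_max_le 0).2 ⟨le_rfl, fun j _ => h j⟩).antisymm (P.phi_nonneg x)⟩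

theorem exists_phi_le_of_pos (h : 0 < P.phi x) : ∃ j, P.phi x ≤ P.f j x :=
  ((Finset.le_fold_max (P.phi x)).1 le_rfl).elim (fun h₀ => absurd h₀ h.not_ge)
    fun ⟨j, _, hj⟩ => ⟨j, hj⟩

theorem continuous_phi (hf : ∀ j, Continuous (P.f j)) : Continuous P.phi := by
  suffices ∀ s : Finset (Fin m), Continuous fun x => s.fold max 0 fun j => P.f j x from this _
  intro s
  induction s using Finset.induction_on with
  | empty => exact continuous_const
  | insert j s hj ih =>
    simp only [Finset.fold_insert hj]
    exact (hf j).max ih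

theorem fbar_of_nonpos (h : P.f j x ≤ 0) : P.fbar j x = P.f j x := if_pos h

theorem fbar_of_pos (h : 0 < P.f j x) : P.fbar j x = P.f j x - P.phi x := if_neg h.not_ge

variable (P j x) in
/-- A continuous minorant of `|f̄_j|` with the same zeros. It replaces `|f̄_j|` in compactness
arguments, because `f̄_j` jumps where `f_j` changes sign. -/
def activityGap : ℝ := min |P.f j x| (P.phi x - P.f j x)

theorem continuous_activityGap (hf : ∀ j, Continuous (P.f j)) (j : Fin m) :
    Continuous (P.activityGap j) :=
  (hf j).abs.min ((continuous_phi hf).sub (hf j))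

theorem abs_activityGap_le : |P.activityGap j x| ≤ |P.fbar j x| := by
  have hgap : 0 ≤ P.phi x - P.f j x := sub_nonneg.2 (P.le_phi j x)
  rw [activityGap, abs_of_nonneg (le_min (abs_nonneg _) hgap)]
  rcases le_or_gt (P.f j x) 0 with h | h
  · exact fbar_of_nonpos h ▸ min_le_left _ _
  · rw [fbar_of_pos h, abs_sub_comm, abs_of_nonneg hgap]
    exact min_le_right _ _

theorem activityGap_eq_zero_iff : P.activityGap j x = 0 ↔ P.fbar j x = 0 := by
  refine ⟨fun h => ?_, fun h => by simpa [h] using P.abs_activityGap_le (j := j) (x := x)⟩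
  unfold activityGap at h
  rcases le_or_gt (P.f j x) 0 with hf | hf
  · rw [fbar_of_nonpos hf]
    rcases min_choice |P.f j x| (P.phi x - P.f j x) with hmin | hmin <;> rw [hmin] at h
    · exact abs_eq_zero.1 h
    · linarith [P.phi_nonneg x]
  · rw [fbar_of_pos hf]
    rcases min_choice |P.f j x| (P.phi x - P.f j x) with hmin | hmin <;> rw [hmin] at h
    · exact absurd (abs_eq_zero.1 h) hf.ne'
    · linarith

theorem exists_norm_le_of_gradientsIndependent (hindep : P.GradientsIndependent)
    (hf : ∀ j, ContDiff ℝ 2 (P.f j)) {K : Set (E n)} (hK : IsCompact K) :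
    ∃ C, ∀ x ∈ K, ∀ h : Fin m → ℝ,
      ‖h‖ ≤ C * (‖∑ j, h j • P.g j x‖ + ∑ j, |P.fbar j x| * |h j|) := by
  obtain ⟨C, hC, hle⟩ := exists_norm_le_of_linearIndependent hK (v := P.g) (w := P.activityGap)
    (fun j => (contDiff_gradient (k := 1) (hf j)).continuous)
    (continuous_activityGap fun j => (hf j).continuous) fun x _ => by
      have hset : {j | P.activityGap j x = 0} = P.activeSet x :=
        Set.ext fun j => activityGap_eq_zero_iff
      rw [hset]
      exact hindep x
  refine ⟨C, fun x hx h => (hle x hx h).trans ?_⟩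
  refine mul_le_mul_of_nonneg_left (add_le_add_right ?_ _) hC.le
  exact Finset.sum_le_sum fun j _ => mul_le_mul_of_nonneg_right abs_activityGap_le (abs_nonneg _)

end Quantities

section LinearSystems

variable {P : Problem n m} {x d d₀ : E n} {B : Matrix (Fin n) (Fin n) ℝ} {j : Fin m}
  {lam r h : Fin m → ℝ} {a M : ℝ}

theorem norm_act_le (hB : B.PosDef) {b : ℝ} (hb : 0 < b)
    (h : ∀ d : E n, ⟪d, act B d⟫_ℝ ≤ b * ‖d‖ ^ 2) (d : E n) : ‖act B d‖ ≤ b * ‖d‖ :=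
  norm_apply_le_of_isPositive (Matrix.isPositive_toEuclideanLin_iff.2 hB.posSemidef) hb h d

theorem IsQPMultiplier.inner_add_inner_add_sum_eq_zero (h : P.IsQPMultiplier x B d lam) :
    ⟪P.g₀ x, d⟫_ℝ + ⟪d, act B d⟫_ℝ + ∑ j, |P.fbar j x| * |lam j| = 0 := by
  have hinner : ⟪P.g₀ x + act B d + ∑ j, lam j • P.g j x, d⟫_ℝ = 0 := by
    rw [h.stationary, inner_zero_left]
  rw [inner_add_left, inner_add_left, sum_inner, real_inner_comm d (act B d)] at hinner
  rw [← hinner]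
  congr 1
  refine Finset.sum_congr rfl fun j _ => ?_
  rw [abs_fbar, abs_of_nonneg (h.nonneg j), real_inner_smul_left]
  linarith [h.complementary j]

theorem diag_nonneg : 0 ≤ P.diag x d₀ j := by
  unfold diag
  positivity

theorem fbar_sq_le_mul_diag (hM : 1 ≤ M) (hg : ‖P.g j x‖ ≤ M) :
    P.fbar j x ^ 2 ≤ M * P.diag x d₀ j := by
  have hinner : |⟪P.g j x, d₀⟫_ℝ| ≤ M * ‖d₀‖ := (abs_real_inner_le_norm _ _).trans (by gcongr)
  have htriangle : |P.fbar j x| ≤ |P.fbar j x + ⟪P.g j x, d₀⟫_ℝ| + |⟪P.g j x, d₀⟫_ℝ| := by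
    simpa using abs_sub (P.fbar j x + ⟪P.g j x, d₀⟫_ℝ) ⟪P.g j x, d₀⟫_ℝ
  have hM' := le_mul_of_one_le_left (abs_nonneg (P.fbar j x + ⟪P.g j x, d₀⟫_ℝ)) hM
  calc P.fbar j x ^ 2 = |P.fbar j x| * |P.fbar j x| := by rw [← sq, sq_abs]
    _ ≤ |P.fbar j x| * (M * (|P.fbar j x + ⟪P.g j x, d₀⟫_ℝ| + ‖d₀‖)) := by
      gcongr
      linarith
    _ = M * P.diag x d₀ j := by rw [diag]; ring

theorem SolvesSLE.energy (hs : P.SolvesSLE x B d₀ r d h) :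
    ⟪d, act B d⟫_ℝ + ∑ j, P.diag x d₀ j * h j ^ 2 = -∑ j, h j * r j := by
  have hinner : ⟪d, act B d + ∑ j, h j • P.g j x⟫_ℝ = 0 := by rw [hs.1, inner_zero_right]
  have hsum : ∑ j, ⟪d, h j • P.g j x⟫_ℝ = ∑ j, P.diag x d₀ j * h j ^ 2 + ∑ j, h j * r j := by
    rw [← Finset.sum_add_distrib]
    refine Finset.sum_congr rfl fun j _ => ?_
    rw [real_inner_smul_right, real_inner_comm, ← hs.2 j]
    ring
  rw [inner_add_right, inner_sum, hsum] at hinner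
  linarith

theorem SolvesSLE.energy_le (hs : P.SolvesSLE x B d₀ r d h) :
    ⟪d, act B d⟫_ℝ + ∑ j, P.diag x d₀ j * h j ^ 2 ≤ m * (‖h‖ * ‖r‖) := by
  rw [hs.energy, ← Finset.sum_neg_distrib]
  calc ∑ j, -(h j * r j) ≤ ∑ _j : Fin m, ‖h‖ * ‖r‖ := Finset.sum_le_sum fun j _ =>
        (neg_le_abs _).trans ((abs_mul _ _).trans_le
          (mul_le_mul (norm_le_pi_norm h j) (norm_le_pi_norm r j) (abs_nonneg _) (norm_nonneg _)))
    _ = m * (‖h‖ * ‖r‖) := by simp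

theorem sum_abs_fbar_mul_sq_le (hM : 1 ≤ M) (hg : ∀ j, ‖P.g j x‖ ≤ M) (d₀ : E n)
    (h : Fin m → ℝ) :
    (∑ j, |P.fbar j x| * |h j|) ^ 2 ≤ m * (M * ∑ j, P.diag x d₀ j * h j ^ 2) :=
  calc (∑ j, |P.fbar j x| * |h j|) ^ 2
      ≤ (Finset.univ : Finset (Fin m)).card * ∑ j, (|P.fbar j x| * |h j|) ^ 2 :=
        sq_sum_le_card_mul_sum_sq
    _ ≤ m * ∑ j, M * (P.diag x d₀ j * h j ^ 2) := by
        rw [Finset.card_univ, Fintype.card_fin]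
        gcongr with j
        rw [mul_pow, sq_abs, sq_abs, ← mul_assoc]
        gcongr
        exact fbar_sq_le_mul_diag hM (hg j)
    _ = m * (M * ∑ j, P.diag x d₀ j * h j ^ 2) := by rw [← Finset.mul_sum]

end LinearSystems

section UniformBounds

/-- Bounds on the problem data at the iterate `x` and on the matrix `B`. Along a bounded run they
hold with constants `a` and `M` that do not depend on the iteration. -/
structure DataBounds (P : Problem n m) (a M : ℝ) (x : E n) (B : Matrix (Fin n) (Fin n) ℝ) :
    Prop where
  g₀_le : ‖P.g₀ x‖ ≤ M
  g_le : ∀ j, ‖P.g j x‖ ≤ M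
  f_le : ∀ j, |P.f j x| ≤ M
  phi_le : P.phi x ≤ M
  act_le : ∀ d : E n, ‖act B d‖ ≤ M * ‖d‖
  coercive : ∀ d : E n, a * ‖d‖ ^ 2 ≤ ⟪d, act B d⟫_ℝ
  independent : ∀ h : Fin m → ℝ,
    ‖h‖ ≤ M * (‖∑ j, h j • P.g j x‖ + ∑ j, |P.fbar j x| * |h j|)

variable {P : Problem n m} {x d d₀ : E n} {B : Matrix (Fin n) (Fin n) ℝ}
  {lam r h : Fin m → ℝ} {a M : ℝ}

theorem exists_dataBounds {x : ℕ → E n} {B : ℕ → Matrix (Fin n) (Fin n) ℝ}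
    (hindep : P.GradientsIndependent) (hpos : ∀ k, (B k).PosDef) (hB : UniformlyPosDef B)
    (hf₀ : ContDiff ℝ 2 P.f₀) (hf : ∀ j, ContDiff ℝ 2 (P.f j))
    (hbdd : Bornology.IsBounded (Set.range x)) :
    ∃ a > 0, ∃ M ≥ 1, ∀ k, P.DataBounds a M (x k) (B k) := by
  obtain ⟨a, b, ha, hb, hab⟩ := hB
  obtain ⟨C, hli⟩ := exists_norm_le_of_gradientsIndependent hindep hf hbdd.isCompact_closure
  obtain ⟨M, hM₁, hbM, hCM, hg₀M, hgM, hfM, hphiM⟩ := ((eventually_ge_atTop 1).and <|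
    (eventually_ge_atTop b).and <| (eventually_ge_atTop C).and <|
    (eventually_forall_norm_le_of_isBounded_range
      (contDiff_gradient (k := 1) hf₀).continuous hbdd).and <|
    (eventually_all.2 fun j => eventually_forall_norm_le_of_isBounded_range
      (contDiff_gradient (k := 1) (hf j)).continuous hbdd).and <|
    (eventually_all.2 fun j => eventually_forall_norm_le_of_isBounded_range
      (hf j).continuous hbdd).and <|
    eventually_forall_norm_le_of_isBounded_range
      (continuous_phi fun j => (hf j).continuous) hbdd).exists
  refine ⟨a, ha, M, hM₁, fun k => ?_⟩
  exact
    { g₀_le := hg₀M k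
      g_le := fun j => hgM j k
      f_le := fun j => hfM j k
      phi_le := (le_abs_self _).trans (hphiM k)
      act_le := fun d => (norm_act_le (hpos k) hb (fun d => (hab k d).2) d).trans (by gcongr)
      coercive := fun d => (hab k d).1
      independent := fun h =>
        (hli _ (subset_closure (Set.mem_range_self k)) h).trans (by gcongr) }

theorem DataBounds.inner_g₀_le (hb : P.DataBounds a M x B) (hlam : P.IsQPMultiplier x B d₀ lam) :
    ⟪P.g₀ x, d₀⟫_ℝ ≤ -(a * ‖d₀‖ ^ 2) := by
  have hsum : 0 ≤ ∑ j, |P.fbar j x| * |lam j| := by positivity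
  linarith [hlam.inner_add_inner_add_sum_eq_zero, hb.coercive d₀]

theorem DataBounds.norm_d₀_le (hb : P.DataBounds a M x B) (ha : 0 < a)
    (hlam : P.IsQPMultiplier x B d₀ lam) : ‖d₀‖ ≤ M / a := by
  have hinner : -⟪P.g₀ x, d₀⟫_ℝ ≤ M * ‖d₀‖ :=
    (neg_le_abs _).trans ((abs_real_inner_le_norm _ _).trans (by gcongr; exact hb.g₀_le))
  have hsq : a * ‖d₀‖ * ‖d₀‖ ≤ M * ‖d₀‖ := by linarith [hb.inner_g₀_le hlam]
  rw [le_div_iff₀' ha]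
  rcases (norm_nonneg d₀).eq_or_lt with h₀ | h₀
  · simpa [← h₀] using (norm_nonneg _).trans hb.g₀_le
  · exact le_of_mul_le_mul_right hsq h₀

theorem DataBounds.norm_lam_le (hb : P.DataBounds a M x B) (ha : 0 < a)
    (hlam : P.IsQPMultiplier x B d₀ lam) :
    ‖lam‖ ≤ M * (M + M * (M / a) + M * (M / a)) := by
  have hM : 0 ≤ M := (norm_nonneg _).trans hb.g₀_le
  have hd₀ := hb.norm_d₀_le ha hlam
  refine (hb.independent lam).trans ?_
  gcongr
  · rw [eq_neg_of_add_eq_zero_right hlam.stationary, norm_neg]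
    exact (norm_add_le _ _).trans (add_le_add hb.g₀_le ((hb.act_le _).trans (by gcongr)))
  · have hpos : 0 ≤ ⟪d₀, act B d₀⟫_ℝ := (by positivity : 0 ≤ a * ‖d₀‖ ^ 2).trans (hb.coercive d₀)
    calc ∑ j, |P.fbar j x| * |lam j| ≤ |⟪P.g₀ x, d₀⟫_ℝ| := by
          linarith [hlam.inner_add_inner_add_sum_eq_zero, neg_abs_le ⟪P.g₀ x, d₀⟫_ℝ]
      _ ≤ ‖P.g₀ x‖ * ‖d₀‖ := abs_real_inner_le_norm _ _
      _ ≤ M * (M / a) := by gcongr; exact hb.g₀_le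

theorem DataBounds.norm_multiplier_le (hb : P.DataBounds a M x B) (ha : 0 < a) (hM : 1 ≤ M)
    (hs : P.SolvesSLE x B d₀ r d h) :
    ‖h‖ ≤ 2 * M ^ 2 * (M ^ 2 / a + m * M) * m * ‖r‖ := by
  have henergy := hs.energy_le
  have hdiag : 0 ≤ ∑ j, P.diag x d₀ j * h j ^ 2 :=
    Finset.sum_nonneg fun j _ => mul_nonneg diag_nonneg (sq_nonneg _)
  have hquad : 0 ≤ a * ‖d‖ ^ 2 := by positivity
  set T := m * (‖h‖ * ‖r‖) with hT
  have hd : ‖d‖ ^ 2 ≤ T / a := by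
    rw [le_div_iff₀' ha]
    linarith [hb.coercive d]
  have hact : ‖act B d‖ ^ 2 ≤ M ^ 2 * (T / a) :=
    calc ‖act B d‖ ^ 2 ≤ (M * ‖d‖) ^ 2 := by gcongr; exact hb.act_le d
      _ = M ^ 2 * ‖d‖ ^ 2 := mul_pow _ _ _
      _ ≤ M ^ 2 * (T / a) := by gcongr
  have hsum : (∑ j, |P.fbar j x| * |h j|) ^ 2 ≤ m * (M * T) := by
    refine (sum_abs_fbar_mul_sq_le hM hb.g_le d₀ h).trans ?_
    gcongr
    linarith [hb.coercive d]
  have hsq : ‖h‖ ^ 2 ≤ 2 * M ^ 2 * (M ^ 2 / a + m * M) * m * ‖r‖ * ‖h‖ :=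
    calc ‖h‖ ^ 2 ≤ (M * (‖act B d‖ + ∑ j, |P.fbar j x| * |h j|)) ^ 2 := by
          gcongr
          simpa only [eq_neg_of_add_eq_zero_right hs.1, norm_neg] using hb.independent h
      _ = M ^ 2 * (‖act B d‖ + ∑ j, |P.fbar j x| * |h j|) ^ 2 := mul_pow _ _ _
      _ ≤ M ^ 2 * (2 * (‖act B d‖ ^ 2 + (∑ j, |P.fbar j x| * |h j|) ^ 2)) := by
          gcongr
          exact add_sq_le
      _ ≤ M ^ 2 * (2 * (M ^ 2 * (T / a) + m * (M * T))) := by gcongr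
      _ = 2 * M ^ 2 * (M ^ 2 / a + m * M) * m * ‖r‖ * ‖h‖ := by rw [hT]; ring
  rcases (norm_nonneg h).eq_or_lt with h₀ | h₀
  · rw [← h₀]
    positivity
  · exact le_of_mul_le_mul_right (by rwa [← sq]) h₀

theorem SolvesSLE.norm_le {C : ℝ} (hs : P.SolvesSLE x B d₀ r d h) (ha : 0 < a)
    (hb : ∀ d : E n, a * ‖d‖ ^ 2 ≤ ⟪d, act B d⟫_ℝ) (hh : ‖h‖ ≤ C * ‖r‖) :
    ‖d‖ ≤ √(m * C / a) * ‖r‖ := by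
  have hdiag : 0 ≤ ∑ j, P.diag x d₀ j * h j ^ 2 :=
    Finset.sum_nonneg fun j _ => mul_nonneg diag_nonneg (sq_nonneg _)
  have hsq : ‖d‖ ^ 2 ≤ m * C / a * ‖r‖ ^ 2 :=
    calc ‖d‖ ^ 2 ≤ m * (‖h‖ * ‖r‖) / a := by
          rw [le_div_iff₀' ha]
          linarith [hb d, hs.energy_le]
      _ ≤ m * (C * ‖r‖ * ‖r‖) / a := by gcongr
      _ = m * C / a * ‖r‖ ^ 2 := by ring
  calc ‖d‖ ≤ √(m * C / a * ‖r‖ ^ 2) := Real.le_sqrt_of_sq_le hsq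
    _ = √(m * C / a) * ‖r‖ := by rw [Real.sqrt_mul' _ (sq_nonneg _), Real.sqrt_sq (norm_nonneg _)]

/-- Bounds on all the quantities that an iteration computes at `x` from the quadratic subproblem,
its multipliers and the linear systems, together with a Lipschitz constant `L` of the gradients
on a ball around `x` that contains every trial point. -/
structure IterateBounds (P : Problem n m) (a M : ℝ) (L : ℝ≥0) (x : E n)
    (B : Matrix (Fin n) (Fin n) ℝ) (d₀ : E n) (lam : Fin m → ℝ) : Prop
    extends P.DataBounds a M x B where
  a_pos : 0 < a
  one_le : 1 ≤ M
  descent : ⟪P.g₀ x, d₀⟫_ℝ ≤ -(a * ‖d₀‖ ^ 2)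
  d₀_le : ‖d₀‖ ≤ M
  lam_le : ‖lam‖ ≤ M
  sle : ∀ {r : Fin m → ℝ} {d : E n} {h : Fin m → ℝ},
    P.SolvesSLE x B d₀ r d h → ‖d‖ ≤ M * ‖r‖ ∧ ‖h‖ ≤ M * ‖r‖
  lipschitz_f₀ : LipschitzOnWith L (∇ P.f₀) (Metric.closedBall x (2 * M ^ 2))
  lipschitz_f : ∀ j, LipschitzOnWith L (∇ (P.f j)) (Metric.closedBall x (2 * M ^ 2))

theorem DataBounds.mono {M' : ℝ} (hb : P.DataBounds a M x B) (h : M ≤ M') :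
    P.DataBounds a M' x B where
  g₀_le := hb.g₀_le.trans h
  g_le j := (hb.g_le j).trans h
  f_le j := (hb.f_le j).trans h
  phi_le := hb.phi_le.trans h
  act_le d := (hb.act_le d).trans (by gcongr)
  coercive := hb.coercive
  independent d := (hb.independent d).trans (by gcongr)

theorem exists_iterateBounds {p : Params} {x : ℕ → E n} {B : ℕ → Matrix (Fin n) (Fin n) ℝ}
    {d₀ : ℕ → E n} {lam : ℕ → Fin m → ℝ} {d₁ : ℕ → E n}
    (hrun : P.IsRun p x B d₀ lam d₁) (hindep : P.GradientsIndependent) (hB : UniformlyPosDef B)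
    (hf₀ : ContDiff ℝ 2 P.f₀) (hf : ∀ j, ContDiff ℝ 2 (P.f j))
    (hbdd : Bornology.IsBounded (Set.range x)) :
    ∃ a M L, ∀ k, P.IterateBounds a M L (x k) (B k) (d₀ k) (lam k) := by
  obtain ⟨a, ha, M, hM, hb⟩ := exists_dataBounds hindep hrun.posDef hB hf₀ hf hbdd
  set C := 2 * M ^ 2 * (M ^ 2 / a + m * M) * m
  obtain ⟨M', hMM', hCM', hdM', hd₀M', hlamM'⟩ := ((eventually_ge_atTop M).and <|
    (eventually_ge_atTop C).and <| (eventually_ge_atTop √(m * C / a)).and <|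
    (eventually_ge_atTop (M / a)).and <|
    eventually_ge_atTop (M * (M + M * (M / a) + M * (M / a)))).exists
  obtain ⟨L, hL₀, hL⟩ := ((eventually_lipschitzOnWith_gradient hf₀ hbdd (2 * M' ^ 2)).and <|
    eventually_all.2 fun j => eventually_lipschitzOnWith_gradient (hf j) hbdd (2 * M' ^ 2)).exists
  refine ⟨a, M', L, fun k => ?_⟩
  exact
    { (hb k).mono hMM' with
      a_pos := ha
      one_le := hM.trans hMM'
      descent := (hb k).inner_g₀_le (hrun.multiplier k)
      d₀_le := ((hb k).norm_d₀_le ha (hrun.multiplier k)).trans hd₀M'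
      lam_le := ((hb k).norm_lam_le ha (hrun.multiplier k)).trans hlamM'
      sle := fun hs => by
        have hh := (hb k).norm_multiplier_le ha hM hs
        exact ⟨(hs.norm_le ha (hb k).coercive hh).trans (by gcongr), hh.trans (by gcongr)⟩
      lipschitz_f₀ := hL₀ k
      lipschitz_f := fun j => hL j k }

end UniformBounds

section FeasibleDirection

variable {P : Problem n m} {p : Params} {x d₀ dt : E n} {B : Matrix (Fin n) (Fin n) ℝ}
  {lam ht : Fin m → ℝ} {a M : ℝ} {L : ℝ≥0}

theorem mul_inner_add_rpow_nonneg (hp : p.Admissible) (hg : ⟪P.g₀ x, d₀⟫_ℝ ≤ 0) :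
    0 ≤ (p.θ - 1) * ⟪P.g₀ x, d₀⟫_ℝ + P.phi x ^ p.θ :=
  add_nonneg (mul_nonneg_of_nonpos_of_nonpos (by linarith [hp.θ_lt, hp.σ_lt]) hg)
    (Real.rpow_nonneg (P.phi_nonneg x) _)

theorem beta_mem_Icc (hp : p.Admissible) (hg : ⟪P.g₀ x, d₀⟫_ℝ ≤ 0) (dt : E n) :
    P.beta p x d₀ dt ∈ Set.Icc 0 1 := by
  unfold beta
  split_ifs with h
  · exact ⟨le_min zero_le_one (div_nonneg (mul_inner_add_rpow_nonneg hp hg) (sub_pos.2 h).le),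
      min_le_left _ _⟩
  · exact ⟨zero_le_one, le_rfl⟩

theorem inner_q (v : E n) :
    ⟪v, P.q p x d₀ dt⟫_ℝ =
      (1 - P.beta p x d₀ dt) * ⟪v, d₀⟫_ℝ + P.beta p x d₀ dt * ⟪v, dt⟫_ℝ := by
  rw [q, inner_add_right, real_inner_smul_right, real_inner_smul_right]

theorem inner_g₀_q_le (hp : p.Admissible) (hg : ⟪P.g₀ x, d₀⟫_ℝ ≤ 0) (dt : E n) :
    ⟪P.g₀ x, P.q p x d₀ dt⟫_ℝ ≤ p.θ * ⟪P.g₀ x, d₀⟫_ℝ + P.phi x ^ p.θ := by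
  have hnum := mul_inner_add_rpow_nonneg hp hg
  suffices P.beta p x d₀ dt * (⟪P.g₀ x, dt⟫_ℝ - ⟪P.g₀ x, d₀⟫_ℝ) ≤
      (p.θ - 1) * ⟪P.g₀ x, d₀⟫_ℝ + P.phi x ^ p.θ by
    rw [inner_q]
    linarith
  unfold beta
  split_ifs with h
  · exact (le_div_iff₀ (sub_pos.2 h)).1 (min_le_right _ _)
  · linarith

theorem DataBounds.abs_fbar_le (hb : P.DataBounds a M x B) (j : Fin m) : |P.fbar j x| ≤ M := by
  rcases le_or_gt (P.f j x) 0 with h | h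
  · exact fbar_of_nonpos h ▸ hb.f_le j
  · rw [abs_fbar, fbar_of_pos h]
    linarith [hb.phi_le]

theorem DataBounds.diag_le (hb : P.DataBounds a M x B) (hM : 1 ≤ M) (hd₀ : ‖d₀‖ ≤ M)
    (j : Fin m) : P.diag x d₀ j ≤ |P.fbar j x| * (3 * M ^ 2) := by
  have hinner : |⟪P.g j x, d₀⟫_ℝ| ≤ M * M :=
    (abs_real_inner_le_norm _ _).trans (by gcongr; exact hb.g_le j)
  have hMM : M ≤ M * M := le_mul_of_one_le_left (by linarith) hM
  unfold diag
  gcongr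
  linarith [abs_add_le (P.fbar j x) ⟪P.g j x, d₀⟫_ℝ, hb.abs_fbar_le j]

namespace IterateBounds

variable (hb : P.IterateBounds a M L x B d₀ lam) (hp : p.Admissible)

include hb

theorem inner_nonpos : ⟪P.g₀ x, d₀⟫_ℝ ≤ 0 :=
  hb.descent.trans (neg_nonpos.2 (mul_nonneg hb.a_pos.le (sq_nonneg _)))

include hp

theorem phi_rpow_le : P.phi x ^ p.σ ≤ M := by
  have hle := rpow_le_mul_rpow (σ := p.σ) (P.phi_nonneg x) hb.phi_le hb.one_le le_rfl
    (hp.θ_pos.trans hp.θ_lt).le (by linarith [hp.σ_lt])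
  simpa using hle

theorem phi_rpow_le_mul_phi_rpow : P.phi x ^ p.σ ≤ M * P.phi x ^ p.θ :=
  rpow_le_mul_rpow (P.phi_nonneg x) hb.phi_le hb.one_le hp.θ_pos.le hp.θ_lt.le
    (by linarith [hp.σ_lt, hp.θ_pos])

theorem mul_sq_add_le_mul_inner_add_rpow {κ : ℝ} (hκ : 0 ≤ κ) (hκa : κ ≤ (1 - p.θ) * a)
    (hκM : κ * M ≤ 1) :
    κ * (‖d₀‖ ^ 2 + P.phi x ^ p.σ) ≤ (p.θ - 1) * ⟪P.g₀ x, d₀⟫_ℝ + P.phi x ^ p.θ := by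
  have hrpow : κ * P.phi x ^ p.σ ≤ P.phi x ^ p.θ :=
    calc κ * P.phi x ^ p.σ ≤ κ * (M * P.phi x ^ p.θ) := by
          gcongr; exact hb.phi_rpow_le_mul_phi_rpow hp
      _ = κ * M * P.phi x ^ p.θ := by ring
      _ ≤ P.phi x ^ p.θ := mul_le_of_le_one_left (Real.rpow_nonneg (P.phi_nonneg x) _) hκM
  have hdescent := mul_le_mul_of_nonneg_left hb.descent
    (by linarith [hp.θ_lt, hp.σ_lt] : 0 ≤ 1 - p.θ)
  linarith [mul_le_mul_of_nonneg_right hκa (sq_nonneg ‖d₀‖)]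

omit hp in
theorem mul_sq_add_le {κ : ℝ} (hκ : 0 ≤ κ) (hκM : κ * M ≤ 1) :
    κ * (‖d₀‖ ^ 2 + P.phi x ^ p.σ) ≤ 2 * M ^ 2 * (‖d₀‖ + P.phi x ^ p.σ) := by
  have hM := hb.one_le
  have hσ : 0 ≤ P.phi x ^ p.σ := Real.rpow_nonneg (P.phi_nonneg x) _
  have hd₀ : κ * ‖d₀‖ ^ 2 ≤ ‖d₀‖ :=
    calc κ * ‖d₀‖ ^ 2 ≤ κ * (M * ‖d₀‖) := by rw [sq]; gcongr; exact hb.d₀_le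
      _ = κ * M * ‖d₀‖ := by ring
      _ ≤ ‖d₀‖ := mul_le_of_le_one_left (norm_nonneg _) hκM
  have hκσ : κ * P.phi x ^ p.σ ≤ P.phi x ^ p.σ :=
    mul_le_of_le_one_left hσ ((le_mul_of_one_le_right hκ hM).trans hκM)
  have hM₂ : 1 ≤ 2 * M ^ 2 := by linarith [one_le_pow₀ hM (n := 2)]
  exact (by linarith : _ ≤ ‖d₀‖ + P.phi x ^ p.σ).trans
    (le_mul_of_one_le_left (by positivity) hM₂)

variable (hs : P.SolvesSLE x B d₀ (P.rhsTilde p x d₀) dt ht)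

include hs

omit hp in
theorem tilde_le : ‖dt‖ ≤ M * (‖d₀‖ + P.phi x ^ p.σ) ∧ ‖ht‖ ≤ M * (‖d₀‖ + P.phi x ^ p.σ) := by
  have hnonneg : 0 ≤ ‖d₀‖ + P.phi x ^ p.σ :=
    add_nonneg (norm_nonneg _) (Real.rpow_nonneg (P.phi_nonneg x) _)
  have hr : ‖P.rhsTilde p x d₀‖ ≤ ‖d₀‖ + P.phi x ^ p.σ :=
    (pi_norm_le_iff_of_nonneg hnonneg).2 fun j => by
      rw [rhsTilde, norm_neg, Real.norm_of_nonneg hnonneg]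
  have hM : 0 ≤ M := zero_le_one.trans hb.one_le
  exact ⟨(hb.sle hs).1.trans (by gcongr), (hb.sle hs).2.trans (by gcongr)⟩

omit hp in
theorem inner_g₀_tilde_sub_le :
    ⟪P.g₀ x, dt⟫_ℝ - ⟪P.g₀ x, d₀⟫_ℝ ≤ 2 * M ^ 2 * (‖d₀‖ + P.phi x ^ p.σ) := by
  have hσ : 0 ≤ P.phi x ^ p.σ := Real.rpow_nonneg (P.phi_nonneg x) _
  calc ⟪P.g₀ x, dt⟫_ℝ - ⟪P.g₀ x, d₀⟫_ℝ = ⟪P.g₀ x, dt - d₀⟫_ℝ := (inner_sub_right _ _ _).symm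
    _ ≤ ‖P.g₀ x‖ * (‖dt‖ + ‖d₀‖) :=
      (real_inner_le_norm _ _).trans (by gcongr; exact norm_sub_le _ _)
    _ ≤ M * (M * (‖d₀‖ + P.phi x ^ p.σ) + M * (‖d₀‖ + P.phi x ^ p.σ)) := by
      gcongr
      · exact zero_le_one.trans hb.one_le
      · exact hb.g₀_le
      · exact (hb.tilde_le hs).1
      · exact (by linarith : ‖d₀‖ ≤ ‖d₀‖ + P.phi x ^ p.σ).trans
          (le_mul_of_one_le_left (by positivity) hb.one_le)
    _ = 2 * M ^ 2 * (‖d₀‖ + P.phi x ^ p.σ) := by ring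

theorem mul_sq_add_le_mul_beta {κ : ℝ} (hκ : 0 ≤ κ) (hκa : κ ≤ (1 - p.θ) * a) (hκM : κ * M ≤ 1) :
    κ * (‖d₀‖ ^ 2 + P.phi x ^ p.σ) ≤
      2 * M ^ 2 * (P.beta p x d₀ dt * (‖d₀‖ + P.phi x ^ p.σ)) := by
  have hone : κ * (‖d₀‖ ^ 2 + P.phi x ^ p.σ) ≤ 2 * M ^ 2 * (1 * (‖d₀‖ + P.phi x ^ p.σ)) := by
    rw [one_mul]
    exact hb.mul_sq_add_le hκ hκM
  unfold beta
  split_ifs with h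
  · rcases min_choice 1 (((p.θ - 1) * ⟪P.g₀ x, d₀⟫_ℝ + P.phi x ^ p.θ) /
      (⟪P.g₀ x, dt⟫_ℝ - ⟪P.g₀ x, d₀⟫_ℝ)) with hmin | hmin <;> rw [hmin]
    · exact hone
    · rw [mul_left_comm, div_mul_eq_mul_div, le_div_iff₀ (sub_pos.2 h)]
      gcongr
      · exact mul_inner_add_rpow_nonneg hp hb.inner_nonpos
      · exact hb.mul_sq_add_le_mul_inner_add_rpow hp hκ hκa hκM
      · exact hb.inner_g₀_tilde_sub_le hs
  · exact hone

theorem norm_q_le :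
    ‖P.q p x d₀ dt‖ ≤ M * (‖d₀‖ + P.beta p x d₀ dt * P.phi x ^ p.σ) := by
  obtain ⟨hβ₀, hβ₁⟩ := beta_mem_Icc hp hb.inner_nonpos dt
  have hd₀ : ‖d₀‖ ≤ M * ‖d₀‖ := le_mul_of_one_le_left (norm_nonneg _) hb.one_le
  calc ‖P.q p x d₀ dt‖ ≤ (1 - P.beta p x d₀ dt) * ‖d₀‖ + P.beta p x d₀ dt * ‖dt‖ := by
        refine (norm_add_le _ _).trans_eq ?_
        rw [norm_smul, norm_smul, Real.norm_of_nonneg (sub_nonneg.2 hβ₁), Real.norm_of_nonneg hβ₀]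
    _ ≤ (1 - P.beta p x d₀ dt) * (M * ‖d₀‖) +
          P.beta p x d₀ dt * (M * (‖d₀‖ + P.phi x ^ p.σ)) :=
        add_le_add (mul_le_mul_of_nonneg_left hd₀ (sub_nonneg.2 hβ₁))
          (mul_le_mul_of_nonneg_left (hb.tilde_le hs).1 hβ₀)
    _ = M * (‖d₀‖ + P.beta p x d₀ dt * P.phi x ^ p.σ) := by ring

theorem norm_q_sq_le :
    ‖P.q p x d₀ dt‖ ^ 2 ≤ 2 * M ^ 2 * (‖d₀‖ ^ 2 + (P.beta p x d₀ dt * P.phi x ^ p.σ) ^ 2) :=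
  calc ‖P.q p x d₀ dt‖ ^ 2 ≤ (M * (‖d₀‖ + P.beta p x d₀ dt * P.phi x ^ p.σ)) ^ 2 := by
        gcongr; exact hb.norm_q_le hp hs
    _ = M ^ 2 * (‖d₀‖ + P.beta p x d₀ dt * P.phi x ^ p.σ) ^ 2 := mul_pow _ _ _
    _ ≤ M ^ 2 * (2 * (‖d₀‖ ^ 2 + (P.beta p x d₀ dt * P.phi x ^ p.σ) ^ 2)) := by
        gcongr; exact add_sq_le
    _ = 2 * M ^ 2 * (‖d₀‖ ^ 2 + (P.beta p x d₀ dt * P.phi x ^ p.σ) ^ 2) := by ring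

theorem norm_q_sq_le_add_phi_rpow :
    ‖P.q p x d₀ dt‖ ^ 2 ≤ 2 * M ^ 4 * (‖d₀‖ ^ 2 + P.phi x ^ p.θ) := by
  obtain ⟨hβ₀, hβ₁⟩ := beta_mem_Icc hp hb.inner_nonpos dt
  have hM : 1 ≤ M ^ 2 := one_le_pow₀ hb.one_le
  have hσ : 0 ≤ P.phi x ^ p.σ := Real.rpow_nonneg (P.phi_nonneg x) _
  have hβσ : (P.beta p x d₀ dt * P.phi x ^ p.σ) ^ 2 ≤ M ^ 2 * P.phi x ^ p.θ :=
    calc (P.beta p x d₀ dt * P.phi x ^ p.σ) ^ 2 ≤ P.phi x ^ p.σ * P.phi x ^ p.σ := by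
          rw [← sq]
          gcongr
          exact mul_le_of_le_one_left hσ hβ₁
      _ ≤ M * (M * P.phi x ^ p.θ) :=
          mul_le_mul (hb.phi_rpow_le hp) (hb.phi_rpow_le_mul_phi_rpow hp) hσ
            (zero_le_one.trans hb.one_le)
      _ = M ^ 2 * P.phi x ^ p.θ := by ring
  calc ‖P.q p x d₀ dt‖ ^ 2
      ≤ 2 * M ^ 2 * (‖d₀‖ ^ 2 + (P.beta p x d₀ dt * P.phi x ^ p.σ) ^ 2) := hb.norm_q_sq_le hp hs
    _ ≤ 2 * M ^ 2 * (M ^ 2 * ‖d₀‖ ^ 2 + M ^ 2 * P.phi x ^ p.θ) := by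
        gcongr
        exact le_mul_of_one_le_left (sq_nonneg _) hM
    _ = 2 * M ^ 4 * (‖d₀‖ ^ 2 + P.phi x ^ p.θ) := by ring

theorem mul_norm_q_sq_le {κ : ℝ} (hκ : 0 ≤ κ) (hκa : κ ≤ (1 - p.θ) * a) (hκM : κ * M ≤ 1) :
    κ * ‖P.q p x d₀ dt‖ ^ 2 ≤
      6 * M ^ 4 * (P.beta p x d₀ dt * (‖d₀‖ + P.phi x ^ p.σ)) := by
  obtain ⟨hβ₀, hβ₁⟩ := beta_mem_Icc hp hb.inner_nonpos dt
  have hM : 1 ≤ M ^ 2 := one_le_pow₀ hb.one_le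
  have hσ : 0 ≤ P.phi x ^ p.σ := Real.rpow_nonneg (P.phi_nonneg x) _
  set W := P.beta p x d₀ dt * (‖d₀‖ + P.phi x ^ p.σ) with hW
  have hβσ : P.beta p x d₀ dt * P.phi x ^ p.σ ≤ W := by
    rw [hW]
    gcongr
    exact le_add_of_nonneg_left (norm_nonneg _)
  have hsq : κ * ‖d₀‖ ^ 2 ≤ 2 * M ^ 2 * W := by
    have hle := hb.mul_sq_add_le_mul_beta hp hs hκ hκa hκM
    have hnonneg : 0 ≤ κ * P.phi x ^ p.σ := mul_nonneg hκ hσ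
    linarith
  have hβσsq : κ * (P.beta p x d₀ dt * P.phi x ^ p.σ) ^ 2 ≤ M ^ 2 * W :=
    calc κ * (P.beta p x d₀ dt * P.phi x ^ p.σ) ^ 2
        ≤ κ * (M * W) := by
          rw [sq]
          gcongr
          · exact zero_le_one.trans hb.one_le
          · exact (mul_le_of_le_one_left hσ hβ₁).trans (hb.phi_rpow_le hp)
      _ = κ * M * W := by ring
      _ ≤ M ^ 2 * W := by gcongr; exact hκM.trans hM
  calc κ * ‖P.q p x d₀ dt‖ ^ 2
      ≤ κ * (2 * M ^ 2 * (‖d₀‖ ^ 2 + (P.beta p x d₀ dt * P.phi x ^ p.σ) ^ 2)) := by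
        gcongr; exact hb.norm_q_sq_le hp hs
    _ = 2 * M ^ 2 * (κ * ‖d₀‖ ^ 2 + κ * (P.beta p x d₀ dt * P.phi x ^ p.σ) ^ 2) := by ring
    _ ≤ 2 * M ^ 2 * (2 * M ^ 2 * W + M ^ 2 * W) := by gcongr
    _ = 6 * M ^ 4 * W := by ring

theorem inner_g_tilde_le (j : Fin m) :
    ⟪P.g j x, dt⟫_ℝ ≤ 6 * M ^ 4 * |P.fbar j x| - (‖d₀‖ + P.phi x ^ p.σ) := by
  have hh : ht j ≤ 2 * M ^ 2 :=
    calc ht j ≤ ‖ht‖ := (le_abs_self _).trans (norm_le_pi_norm ht j)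
      _ ≤ M * (‖d₀‖ + P.phi x ^ p.σ) := (hb.tilde_le hs).2
      _ ≤ M * (M + M) := by
        have hM := hb.one_le
        gcongr
        · exact hb.d₀_le
        · exact hb.phi_rpow_le hp
      _ = 2 * M ^ 2 := by ring
  have hdiag : P.diag x d₀ j * ht j ≤ 6 * M ^ 4 * |P.fbar j x| :=
    calc P.diag x d₀ j * ht j ≤ P.diag x d₀ j * (2 * M ^ 2) :=
          mul_le_mul_of_nonneg_left hh diag_nonneg
      _ ≤ |P.fbar j x| * (3 * M ^ 2) * (2 * M ^ 2) := by
        gcongr; exact hb.diag_le hb.one_le hb.d₀_le j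
      _ = 6 * M ^ 4 * |P.fbar j x| := by ring
  have heq : ⟪P.g j x, dt⟫_ℝ - P.diag x d₀ j * ht j = -(‖d₀‖ + P.phi x ^ p.σ) := hs.2 j
  linarith

theorem inner_g_q_le (hfeas : P.QPFeasible x d₀) (j : Fin m) :
    ⟪P.g j x, P.q p x d₀ dt⟫_ℝ ≤
      6 * M ^ 4 * |P.fbar j x| - P.beta p x d₀ dt * (‖d₀‖ + P.phi x ^ p.σ) := by
  obtain ⟨hβ₀, hβ₁⟩ := beta_mem_Icc hp hb.inner_nonpos dt
  have hM : 1 ≤ M ^ 4 := one_le_pow₀ hb.one_le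
  have hd₀ : ⟪P.g j x, d₀⟫_ℝ ≤ 6 * M ^ 4 * |P.fbar j x| :=
    calc ⟪P.g j x, d₀⟫_ℝ ≤ |P.fbar j x| := by linarith [hfeas j, P.abs_fbar j x]
      _ ≤ 6 * M ^ 4 * |P.fbar j x| := le_mul_of_one_le_left (abs_nonneg _) (by linarith)
  calc ⟪P.g j x, P.q p x d₀ dt⟫_ℝ
      ≤ (1 - P.beta p x d₀ dt) * (6 * M ^ 4 * |P.fbar j x|) +
        P.beta p x d₀ dt * (6 * M ^ 4 * |P.fbar j x| - (‖d₀‖ + P.phi x ^ p.σ)) := by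
        rw [inner_q]
        exact add_le_add (mul_le_mul_of_nonneg_left hd₀ (sub_nonneg.2 hβ₁))
          (mul_le_mul_of_nonneg_left (hb.inner_g_tilde_le hp hs j) hβ₀)
    _ = 6 * M ^ 4 * |P.fbar j x| - P.beta p x d₀ dt * (‖d₀‖ + P.phi x ^ p.σ) := by ring

theorem apply_add_smul_q_le {h : E n → ℝ} (hh : Differentiable ℝ h)
    (hL : LipschitzOnWith L (∇ h) (Metric.closedBall x (2 * M ^ 2))) {t : ℝ} (ht₀ : 0 ≤ t)
    (ht₁ : t ≤ 1) :
    h (x + t • P.q p x d₀ dt) ≤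
      h x + t * ⟪∇ h x, P.q p x d₀ dt⟫_ℝ + t * (t * L * ‖P.q p x d₀ dt‖ ^ 2) := by
  have hβ₁ := (beta_mem_Icc hp hb.inner_nonpos dt).2
  have hM : 0 ≤ M := zero_le_one.trans hb.one_le
  have hσ : 0 ≤ P.phi x ^ p.σ := Real.rpow_nonneg (P.phi_nonneg x) _
  have hnorm : ‖t • P.q p x d₀ dt‖ = t * ‖P.q p x d₀ dt‖ := by
    rw [norm_smul, Real.norm_of_nonneg ht₀]
  have hball : x + t • P.q p x d₀ dt ∈ Metric.closedBall x (2 * M ^ 2) := by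
    rw [mem_closedBall_iff_norm, add_sub_cancel_left, hnorm]
    calc t * ‖P.q p x d₀ dt‖ ≤ 1 * (M * (M + 1 * M)) := by
          gcongr
          refine (hb.norm_q_le hp hs).trans ?_
          gcongr
          · exact hb.d₀_le
          · exact hb.phi_rpow_le hp
      _ = 2 * M ^ 2 := by ring
  have htaylor := (abs_le.1 (abs_sub_sub_inner_gradient_le hh (convex_closedBall x _) hL
    (Metric.mem_closedBall_self (by positivity)) hball)).2
  rw [real_inner_smul_right, hnorm] at htaylor
  linarith

theorem f_add_smul_q_le (hf : ∀ j, Differentiable ℝ (P.f j)) (hfeas : P.QPFeasible x d₀)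
    {κ t : ℝ} (hκ : 0 < κ) (hκa : κ ≤ (1 - p.θ) * a) (hκM : κ * M ≤ 1) (ht₀ : 0 ≤ t)
    (ht₁ : t * (6 * M ^ 4) ≤ 1) (htκ : t * L * (6 * M ^ 4) ≤ (1 - p.γ) * κ) (j : Fin m) :
    P.f j (x + t • P.q p x d₀ dt) ≤ P.f j x + |P.fbar j x| -
      p.γ * t * (P.beta p x d₀ dt * (‖d₀‖ + P.phi x ^ p.σ)) := by
  have hβ₀ := (beta_mem_Icc hp hb.inner_nonpos dt).1
  have hσ : 0 ≤ P.phi x ^ p.σ := Real.rpow_nonneg (P.phi_nonneg x) _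
  have hM : 1 ≤ M ^ 4 := one_le_pow₀ hb.one_le
  have htaylor := hb.apply_add_smul_q_le hp hs (hf j) (hb.lipschitz_f j) ht₀
    ((le_mul_of_one_le_right ht₀ (by linarith)).trans ht₁)
  set W := P.beta p x d₀ dt * (‖d₀‖ + P.phi x ^ p.σ)
  have hquad : t * L * ‖P.q p x d₀ dt‖ ^ 2 ≤ (1 - p.γ) * W := by
    refine le_of_mul_le_mul_left ?_ hκ
    calc κ * (t * L * ‖P.q p x d₀ dt‖ ^ 2) = t * L * (κ * ‖P.q p x d₀ dt‖ ^ 2) := by ring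
      _ ≤ t * L * (6 * M ^ 4 * W) :=
        mul_le_mul_of_nonneg_left (hb.mul_norm_q_sq_le hp hs hκ.le hκa hκM) (by positivity)
      _ = t * L * (6 * M ^ 4) * W := by ring
      _ ≤ (1 - p.γ) * κ * W := by gcongr
      _ = κ * ((1 - p.γ) * W) := by ring
  have hlin : t * ⟪∇ (P.f j) x, P.q p x d₀ dt⟫_ℝ ≤ |P.fbar j x| - t * W :=
    calc t * ⟪∇ (P.f j) x, P.q p x d₀ dt⟫_ℝ ≤ t * (6 * M ^ 4 * |P.fbar j x| - W) := by
          gcongr; exact hb.inner_g_q_le hp hs hfeas j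
      _ = t * (6 * M ^ 4) * |P.fbar j x| - t * W := by ring
      _ ≤ |P.fbar j x| - t * W := by
          gcongr; exact mul_le_of_le_one_left (abs_nonneg _) ht₁
  linarith [mul_le_mul_of_nonneg_left hquad ht₀]

theorem f₀_add_smul_q_le (hf₀ : Differentiable ℝ P.f₀) {t : ℝ} (ht₀ : 0 ≤ t) (ht₁ : t ≤ 1)
    (hta : t * L * (2 * M ^ 4) ≤ (1 - p.γ) * (p.θ * a))
    (htρ : t * L * (2 * M ^ 4) ≤ (1 - p.γ) * (p.ρ - 1)) :
    P.f₀ (x + t • P.q p x d₀ dt) ≤ P.f₀ x + p.γ * t * ⟪P.g₀ x, P.q p x d₀ dt⟫_ℝ +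
      p.ρ * (1 - p.γ) * t * P.phi x ^ p.θ := by
  have hγ : 0 ≤ 1 - p.γ := sub_nonneg.2 hp.γ_mem.2.le
  have hphi : 0 ≤ P.phi x ^ p.θ := Real.rpow_nonneg (P.phi_nonneg x) _
  have htaylor := hb.apply_add_smul_q_le hp hs hf₀ hb.lipschitz_f₀ ht₀ ht₁
  have hlin : ⟪P.g₀ x, P.q p x d₀ dt⟫_ℝ ≤ -(p.θ * a * ‖d₀‖ ^ 2) + P.phi x ^ p.θ := by
    linarith [inner_g₀_q_le hp hb.inner_nonpos dt,
      mul_le_mul_of_nonneg_left hb.descent hp.θ_pos.le]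
  have hquad : t * L * ‖P.q p x d₀ dt‖ ^ 2 ≤
      (1 - p.γ) * (p.θ * a * ‖d₀‖ ^ 2 + (p.ρ - 1) * P.phi x ^ p.θ) :=
    calc t * L * ‖P.q p x d₀ dt‖ ^ 2
        ≤ t * L * (2 * M ^ 4 * (‖d₀‖ ^ 2 + P.phi x ^ p.θ)) := by
          gcongr; exact hb.norm_q_sq_le_add_phi_rpow hp hs
      _ = t * L * (2 * M ^ 4) * ‖d₀‖ ^ 2 + t * L * (2 * M ^ 4) * P.phi x ^ p.θ := by ring
      _ ≤ (1 - p.γ) * (p.θ * a) * ‖d₀‖ ^ 2 + (1 - p.γ) * (p.ρ - 1) * P.phi x ^ p.θ := by gcongr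
      _ = (1 - p.γ) * (p.θ * a * ‖d₀‖ ^ 2 + (p.ρ - 1) * P.phi x ^ p.θ) := by ring
  change P.f₀ (x + t • P.q p x d₀ dt) ≤ P.f₀ x + t * ⟪P.g₀ x, P.q p x d₀ dt⟫_ℝ + _ at htaylor
  linarith [mul_le_mul_of_nonneg_left
    (add_le_add hquad (mul_le_mul_of_nonneg_left hlin hγ)) ht₀]

end IterateBounds

theorem exists_forall_acceptII (P : Problem n m) (hp : p.Admissible) (hf₀ : Differentiable ℝ P.f₀)
    (hf : ∀ j, Differentiable ℝ (P.f j)) (ha : 0 < a) (hM : 1 ≤ M) (L : ℝ≥0) :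
    ∃ T > 0, ∀ {x B d₀ lam dt ht}, P.IterateBounds a M L x B d₀ lam → P.QPFeasible x d₀ →
      P.SolvesSLE x B d₀ (P.rhsTilde p x d₀) dt ht →
      ∀ t, 0 < t → t ≤ T → P.AcceptII p x d₀ dt t := by
  have hγ : 0 < 1 - p.γ := sub_pos.2 hp.γ_mem.2
  have hθ : 0 < 1 - p.θ := by linarith [hp.θ_lt, hp.σ_lt]
  have hρ : 0 < p.ρ - 1 := sub_pos.2 hp.ρ_gt
  have hM₀ : 0 < M := zero_lt_one.trans_le hM
  have hθa : 0 < p.θ * a := mul_pos hp.θ_pos ha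
  set κ := min ((1 - p.θ) * a) M⁻¹
  have hκ : 0 < κ := by positivity
  have hκM : κ * M ≤ 1 :=
    (mul_le_mul_of_nonneg_right (min_le_right _ _) hM₀.le).trans_eq (inv_mul_cancel₀ hM₀.ne')
  have hsmall {c C : ℝ} (hc : 0 < c) : ∀ᶠ t in 𝓝[>] 0, t * C ≤ c := by
    have hlim : Tendsto (fun t => t * C) (𝓝 0) (𝓝 (0 * C)) := tendsto_id.mul_const C
    rw [zero_mul] at hlim
    exact nhdsWithin_le_nhds (hlim.eventually_le_const hc)
  obtain ⟨T, hT₀, hT⟩ := mem_nhdsGT_iff_exists_Ioc_subset.1 <|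
    (hsmall (C := 6 * M ^ 4) one_pos).and <|
    (hsmall (C := L * (6 * M ^ 4)) (mul_pos hγ hκ)).and <|
    (hsmall (C := 1) one_pos).and <|
    (hsmall (C := L * (2 * M ^ 4)) (mul_pos hγ hθa)).and <|
    hsmall (C := L * (2 * M ^ 4)) (mul_pos hγ hρ)
  refine ⟨T, hT₀, fun {x B d₀ lam dt ht} hb hfeas hs t ht₀ htT => ?_⟩
  obtain ⟨ht₁, htκ, htone, hta, htρ⟩ := hT ⟨ht₀, htT⟩
  simp only [← mul_assoc t (L : ℝ)] at htκ hta htρ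
  have hdecrease := hb.f_add_smul_q_le hp hs hf hfeas hκ (min_le_left _ _) hκM ht₀.le ht₁ htκ
  refine ⟨hb.f₀_add_smul_q_le hp hs hf₀ ht₀.le (by simpa using htone) hta htρ,
    fun j hj => ?_, fun j hj => ?_⟩
  · have hle := hdecrease j
    rw [abs_fbar, fbar_of_pos hj] at hle
    linarith
  · have hβ := (beta_mem_Icc hp hb.inner_nonpos dt).1
    have hσ : 0 ≤ P.phi x ^ p.σ := Real.rpow_nonneg (P.phi_nonneg x) _
    have hγ₀ := hp.γ_mem.1
    refine (hdecrease j).trans ?_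
    rw [abs_fbar, fbar_of_nonpos hj, add_neg_cancel, zero_sub, neg_nonpos]
    positivity

end FeasibleDirection

section GlobalConvergence

/-- The progress that every iteration makes from `x` to `x'`, for a rate `κ` independent of the
iteration: satisfied constraints stay satisfied, violated ones are reduced below `φ - κ φ^σ`, and
from a feasible point the objective decreases by at least `κ ‖d₀‖²`. -/
structure Progress (P : Problem n m) (p : Params) (κ : ℝ) (x d₀ x' : E n) : Prop where
  satisfied : ∀ j, P.f j x ≤ 0 → P.f j x' ≤ 0
  violated : ∀ j, 0 < P.f j x → P.f j x' ≤ P.phi x - κ * P.phi x ^ p.σ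
  objective : P.phi x = 0 → P.f₀ x' ≤ P.f₀ x - κ * ‖d₀‖ ^ 2

variable {P : Problem n m} {p : Params} {κ a M : ℝ} {L : ℝ≥0}

section Iteration

variable {x d₀ d₁ x' : E n} {B : Matrix (Fin n) (Fin n) ℝ} {lam : Fin m → ℝ}

theorem Progress.mono {κ' : ℝ} (h : P.Progress p κ x d₀ x') (hκ : κ' ≤ κ) :
    P.Progress p κ' x d₀ x' where
  satisfied := h.satisfied
  violated j hj := (h.violated j hj).trans
    (by gcongr; exact Real.rpow_nonneg (P.phi_nonneg x) _)
  objective h₀ := (h.objective h₀).trans (by gcongr)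

theorem Progress.phi_le (h : P.Progress p κ x d₀ x') (hpos : 0 < P.phi x') :
    P.phi x' ≤ P.phi x - κ * P.phi x ^ p.σ := by
  obtain ⟨j, hj⟩ := exists_phi_le_of_pos hpos
  rcases le_or_gt (P.f j x) 0 with hle | hlt
  · exact absurd (hj.trans (h.satisfied j hle)) hpos.not_ge
  · exact hj.trans (h.violated j hlt)

theorem Progress.phi_eq_zero (h : P.Progress p κ x d₀ x') (h₀ : P.phi x = 0) : P.phi x' = 0 :=
  phi_eq_zero_iff.2 fun j => h.satisfied j (phi_eq_zero_iff.1 h₀ j)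

theorem CycleI.progress (h : P.CycleI p x d₀ d₁ x') (hp : p.Admissible)
    (hb : P.IterateBounds a M L x B d₀ lam) : P.Progress p (p.α * p.ε * min 1 a) x d₀ x' := by
  obtain ⟨-, i, hi, hacc, -, rfl⟩ := h
  have hα := hp.α_mem.1
  have ha := hb.a_pos
  have hσ : 0 ≤ P.phi x ^ p.σ := Real.rpow_nonneg (P.phi_nonneg x) _
  refine ⟨hacc.satisfied, fun j hj => (hacc.violated j hj).trans ?_, fun h₀ => ?_⟩
  · have hτ : 0 ≤ ‖d₀‖ ^ p.τ := Real.rpow_nonneg (norm_nonneg _) _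
    gcongr ?_ - ?_
    calc p.α * p.ε * min 1 a * P.phi x ^ p.σ ≤ p.α * (1 / 2) ^ i * 1 * P.phi x ^ p.σ := by
          gcongr; exact min_le_left _ _
      _ ≤ p.α * (1 / 2) ^ i * (‖d₀‖ ^ p.τ + P.phi x ^ p.σ) := by
          rw [mul_one]
          gcongr
          exact le_add_of_nonneg_left hτ
  · have hobj := hacc.objective
    rw [h₀, Real.zero_rpow hp.θ_pos.ne', mul_zero, add_zero] at hobj
    refine hobj.trans ?_
    rw [sub_eq_add_neg]
    gcongr
    calc p.α * (1 / 2) ^ i * ⟪P.g₀ x, d₀⟫_ℝ ≤ p.α * (1 / 2) ^ i * -(a * ‖d₀‖ ^ 2) := by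
          gcongr; exact hb.descent
      _ = -(p.α * (1 / 2) ^ i * a * ‖d₀‖ ^ 2) := by ring
      _ ≤ -(p.α * p.ε * min 1 a * ‖d₀‖ ^ 2) := by
          gcongr; exact min_le_right _ _

theorem AcceptII.progress {dt : E n} {ht : Fin m → ℝ} {c t T : ℝ}
    (hacc : P.AcceptII p x d₀ dt t) (hp : p.Admissible)
    (hb : P.IterateBounds a M L x B d₀ lam) (hs : P.SolvesSLE x B d₀ (P.rhsTilde p x d₀) dt ht)
    (hc : 0 < c) (hca : c ≤ (1 - p.θ) * a) (hcM : c * M ≤ 1) (hT : 0 < T) (hTt : T ≤ t) :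
    P.Progress p (p.γ * T * min (c / (2 * M ^ 2)) (p.θ * a)) x d₀
      (x + t • P.q p x d₀ dt) := by
  have hγ := hp.γ_mem.1
  have hθa : 0 < p.θ * a := mul_pos hp.θ_pos hb.a_pos
  have hM : 0 < M := zero_lt_one.trans_le hb.one_le
  have hσ : 0 ≤ P.phi x ^ p.σ := Real.rpow_nonneg (P.phi_nonneg x) _
  have ht : 0 < t := hT.trans_le hTt
  refine ⟨hacc.satisfied, fun j hj => (hacc.violated j hj).trans ?_, fun h₀ => ?_⟩
  · have hβ : c / (2 * M ^ 2) * P.phi x ^ p.σ ≤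
        P.beta p x d₀ dt * (‖d₀‖ + P.phi x ^ p.σ) := by
      rw [div_mul_eq_mul_div, div_le_iff₀' (by positivity)]
      exact (by gcongr; exact le_add_of_nonneg_left (sq_nonneg _) :
        c * P.phi x ^ p.σ ≤ c * (‖d₀‖ ^ 2 + P.phi x ^ p.σ)).trans
        (hb.mul_sq_add_le_mul_beta hp hs hc.le hca hcM)
    gcongr ?_ - ?_
    calc p.γ * T * min (c / (2 * M ^ 2)) (p.θ * a) * P.phi x ^ p.σ
        ≤ p.γ * t * (c / (2 * M ^ 2)) * P.phi x ^ p.σ := by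
          gcongr; exact min_le_left _ _
      _ = p.γ * t * (c / (2 * M ^ 2) * P.phi x ^ p.σ) := by ring
      _ ≤ p.γ * t * (P.beta p x d₀ dt * (‖d₀‖ + P.phi x ^ p.σ)) := by gcongr
      _ = p.γ * t * P.beta p x d₀ dt * (‖d₀‖ + P.phi x ^ p.σ) := by ring
  · have hobj := hacc.objective
    have hq := inner_g₀_q_le hp hb.inner_nonpos dt
    rw [h₀, Real.zero_rpow hp.θ_pos.ne', add_zero] at hq
    rw [h₀, Real.zero_rpow hp.θ_pos.ne', mul_zero, add_zero] at hobj
    refine hobj.trans ?_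
    rw [sub_eq_add_neg]
    gcongr
    calc p.γ * t * ⟪P.g₀ x, P.q p x d₀ dt⟫_ℝ
        ≤ p.γ * t * (p.θ * -(a * ‖d₀‖ ^ 2)) := by
          gcongr
          exact hq.trans (mul_le_mul_of_nonneg_left hb.descent hp.θ_pos.le)
      _ = -(p.γ * t * (p.θ * a) * ‖d₀‖ ^ 2) := by ring
      _ ≤ -(p.γ * T * min (c / (2 * M ^ 2)) (p.θ * a) * ‖d₀‖ ^ 2) := by
          gcongr; exact min_le_right _ _

end Iteration

section Run

variable {x : ℕ → E n} {B : ℕ → Matrix (Fin n) (Fin n) ℝ} {d₀ d₁ : ℕ → E n}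
  {lam : ℕ → Fin m → ℝ}

theorem exists_progress (hrun : P.IsRun p x B d₀ lam d₁) (hp : p.Admissible)
    (hb : ∀ k, P.IterateBounds a M L (x k) (B k) (d₀ k) (lam k))
    (hf₀ : Differentiable ℝ P.f₀) (hf : ∀ j, Differentiable ℝ (P.f j)) :
    ∃ κ > 0, ∀ k, P.Progress p κ (x k) (d₀ k) (x (k + 1)) := by
  have ha := (hb 0).a_pos
  have hM : 0 < M := zero_lt_one.trans_le (hb 0).one_le
  have hα := hp.α_mem.1
  have hγ := hp.γ_mem.1
  have hε := hp.ε_mem.1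
  have hη := hp.η_mem.1
  have hθ := hp.θ_pos
  have hθ₁ : 0 < 1 - p.θ := by linarith [hp.θ_lt, hp.σ_lt]
  obtain ⟨T, hT, hacc⟩ := exists_forall_acceptII P hp hf₀ hf ha (hb 0).one_le L
  set c := min ((1 - p.θ) * a) M⁻¹
  have hc : 0 < c := by positivity
  have hcM : c * M ≤ 1 :=
    (mul_le_mul_of_nonneg_right (min_le_right _ _) hM.le).trans_eq (inv_mul_cancel₀ hM.ne')
  refine ⟨min (p.α * p.ε * min 1 a) (p.γ * min 1 (p.η * T) * min (c / (2 * M ^ 2)) (p.θ * a)),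
    by positivity, fun k => ?_⟩
  rcases hrun.update k with hI | ⟨-, dt, ht, hs, i, hi, hfirst, hx⟩
  · exact (hI.progress hp (hb k)).mono (min_le_left _ _)
  · rw [hx]
    have hstep := min_one_mul_le_pow_of_first hη (hacc (hb k) (hrun.qp k).1 hs) hfirst
    exact (hi.progress hp (hb k) hs hc (min_le_left _ _) hcM (by positivity) hstep).mono
      (min_le_right _ _)

theorem exists_phi_eq_zero_of_progress (hp : p.Admissible) (hκ : 0 < κ)
    (h : ∀ k, P.Progress p κ (x k) (d₀ k) (x (k + 1))) : ∃ k, P.phi (x k) = 0 := by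
  by_contra! hne
  have hpos (k : ℕ) : 0 < P.phi (x k) := (P.phi_nonneg _).lt_of_ne' (hne k)
  exact not_forall_pos_of_le_sub_rpow hκ (hp.θ_pos.trans hp.θ_lt) hp.σ_lt
    (u := fun k => P.phi (x k)) (fun k => (h k).phi_le (hpos _)) hpos

theorem eventually_phi_eq_zero_of_progress (hp : p.Admissible) (hκ : 0 < κ)
    (h : ∀ k, P.Progress p κ (x k) (d₀ k) (x (k + 1))) : ∀ᶠ k in atTop, P.phi (x k) = 0 := by
  obtain ⟨k₀, hk₀⟩ := exists_phi_eq_zero_of_progress hp hκ h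
  filter_upwards [eventually_ge_atTop k₀] with k hk
  induction k, hk using Nat.le_induction with
  | base => exact hk₀
  | succ k _ ih => exact (h k).phi_eq_zero ih

theorem tendsto_d₀_of_progress (hκ : 0 < κ)
    (h : ∀ k, P.Progress p κ (x k) (d₀ k) (x (k + 1))) (hfeas : ∀ᶠ k in atTop, P.phi (x k) = 0)
    (hf₀ : Continuous P.f₀) (hbdd : Bornology.IsBounded (Set.range x)) :
    Tendsto d₀ atTop (𝓝 0) := by
  obtain ⟨k₀, hk₀⟩ := eventually_atTop.1 hfeas
  obtain ⟨C, hC⟩ := (eventually_forall_norm_le_of_isBounded_range hf₀ hbdd).exists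
  have hmul := tendsto_zero_of_forall_le_sub (u := fun i => P.f₀ (x (i + k₀)))
    (v := fun i => κ * ‖d₀ (i + k₀)‖ ^ 2) (fun i => by positivity)
    ⟨-C, Set.forall_mem_range.2 fun i => (abs_le.1 (hC _)).1⟩ fun i => by
      rw [add_right_comm]
      exact (h _).objective (hk₀ _ (Nat.le_add_left _ _))
  have hsq : Tendsto (fun i => ‖d₀ (i + k₀)‖ ^ 2) atTop (𝓝 0) := by
    simpa [inv_mul_cancel_left₀ hκ.ne'] using hmul.const_mul κ⁻¹
  have hnorm : Tendsto (fun i => ‖d₀ (i + k₀)‖) atTop (𝓝 0) := by simpa using hsq.sqrt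
  exact (tendsto_add_atTop_iff_nat k₀).1 (tendsto_zero_iff_norm_tendsto_zero.2 hnorm)

end Run

end GlobalConvergence

section LocalConvergence

variable {P : Problem n m} {p : Params} {x : ℕ → E n} {B : ℕ → Matrix (Fin n) (Fin n) ℝ}
  {d₀ : ℕ → E n} {lam : ℕ → Fin m → ℝ} {d₁ : ℕ → E n} {a M : ℝ} {L : ℝ≥0} {l : Filter ℕ}
  {xstar : E n} {mu : Fin m → ℝ}

theorem contDiff_lagrangian (hf₀ : ContDiff ℝ 2 P.f₀) (hf : ∀ j, ContDiff ℝ 2 (P.f j))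
    (mu : Fin m → ℝ) : ContDiff ℝ 2 (P.lagrangian mu) :=
  hf₀.add (ContDiff.sum fun j _ => contDiff_const.mul (hf j))

theorem gradient_lagrangian (hf₀ : Differentiable ℝ P.f₀) (hf : ∀ j, Differentiable ℝ (P.f j))
    (mu : Fin m → ℝ) (z : E n) :
    ∇ (P.lagrangian mu) z = P.g₀ z + ∑ j, mu j • P.g j z := by
  have hder := (hf₀ z).hasGradientAt.hasFDerivAt.add (HasFDerivAt.fun_sum (u := Finset.univ)
    fun j _ => (hf j z).hasGradientAt.hasFDerivAt.const_mul (mu j))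
  refine HasGradientAt.gradient (hasGradientAt_iff_hasFDerivAt.2 (hder.congr_fderiv ?_))
  ext v
  simp [g₀, g]

theorem IsQPMultiplier.sum_sub_smul_g_eq {x d : E n} {B : Matrix (Fin n) (Fin n) ℝ}
    {lam : Fin m → ℝ} (h : P.IsQPMultiplier x B d lam) (mu : Fin m → ℝ) :
    ∑ j, (lam j - mu j) • P.g j x = -(P.g₀ x + ∑ j, mu j • P.g j x + act B d) := by
  simp only [sub_smul, Finset.sum_sub_distrib]
  rw [eq_neg_of_add_eq_zero_right h.stationary]
  abel

/-- The asymptotic regime of a run along a filter `l`: the iterates satisfy uniform bounds, they are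
feasible, and the solutions `d₀` of the quadratic subproblems tend to `0`. It is used with
`l = atTop` and with the filters that refine `atTop` by making `x` converge. -/
structure RegularRun (P : Problem n m) (p : Params) (x : ℕ → E n)
    (B : ℕ → Matrix (Fin n) (Fin n) ℝ) (d₀ : ℕ → E n) (lam : ℕ → Fin m → ℝ) (d₁ : ℕ → E n)
    (a M : ℝ) (L : ℝ≥0) (l : Filter ℕ) : Prop where
  contDiff₀ : ContDiff ℝ 2 P.f₀
  contDiff : ∀ j, ContDiff ℝ 2 (P.f j)
  admissible : p.Admissible
  run : P.IsRun p x B d₀ lam d₁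
  bounds : ∀ k, P.IterateBounds a M L (x k) (B k) (d₀ k) (lam k)
  feasible : ∀ᶠ k in l, P.phi (x k) = 0
  tendsto_d₀ : Tendsto d₀ l (𝓝 0)

namespace RegularRun

variable (h : P.RegularRun p x B d₀ lam d₁ a M L l) (hx : Tendsto x l (𝓝 xstar))
include h

theorem mono {l' : Filter ℕ} (hl : l' ≤ l) : P.RegularRun p x B d₀ lam d₁ a M L l' :=
  { h with feasible := hl h.feasible, tendsto_d₀ := h.tendsto_d₀.mono_left hl }

theorem eventually_f_nonpos : ∀ᶠ k in l, ∀ j, P.f j (x k) ≤ 0 :=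
  h.feasible.mono fun _ => phi_eq_zero_iff.1

theorem act_d₀_isBigO : (fun k => act (B k) (d₀ k)) =O[l] d₀ :=
  .of_bound M (.of_forall fun k => (h.bounds k).act_le (d₀ k))

theorem tendsto_act_d₀ : Tendsto (fun k => act (B k) (d₀ k)) l (𝓝 0) :=
  h.act_d₀_isBigO.trans_tendsto h.tendsto_d₀

include hx

theorem tendsto_g₀ : Tendsto (fun k => P.g₀ (x k)) l (𝓝 (P.g₀ xstar)) :=
  ((contDiff_gradient (k := 1) h.contDiff₀).continuous.tendsto _).comp hx

theorem tendsto_g (j : Fin m) : Tendsto (fun k => P.g j (x k)) l (𝓝 (P.g j xstar)) :=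
  ((contDiff_gradient (k := 1) (h.contDiff j)).continuous.tendsto _).comp hx

theorem tendsto_f (j : Fin m) : Tendsto (fun k => P.f j (x k)) l (𝓝 (P.f j xstar)) :=
  ((h.contDiff j).continuous.tendsto _).comp hx

theorem tendsto_fbar (j : Fin m) : Tendsto (fun k => P.fbar j (x k)) l (𝓝 (P.f j xstar)) :=
  (h.tendsto_f hx j).congr' (h.eventually_f_nonpos.mono fun _ hk => (fbar_of_nonpos (hk j)).symm)

theorem tendsto_fbar_add_inner (j : Fin m) :
    Tendsto (fun k => P.fbar j (x k) + ⟪P.g j (x k), d₀ k⟫_ℝ) l (𝓝 (P.f j xstar)) := by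
  simpa using (h.tendsto_fbar hx j).add ((h.tendsto_g hx j).inner h.tendsto_d₀)

theorem exists_isKKTPair [l.NeBot] : ∃ mu, P.IsKKTPair xstar mu := by
  obtain ⟨mu, -, hmu⟩ := (isCompact_closedBall (0 : Fin m → ℝ) M).ultrafilter_le_nhds'
    ((Ultrafilter.of l).map lam)
    (Ultrafilter.mem_map.2 (univ_mem' fun k => by simpa using (h.bounds k).lam_le))
  replace h := h.mono (Ultrafilter.of_le l)
  replace hx := hx.mono_left (Ultrafilter.of_le l)
  have hlam : ∀ j, Tendsto (fun k => lam k j) (Ultrafilter.of l) (𝓝 (mu j)) :=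
    tendsto_pi_nhds.1 hmu
  refine ⟨mu, ?_, fun j => ?_, fun j => ?_, fun j => ?_⟩
  · have hlim := ((h.tendsto_g₀ hx).add h.tendsto_act_d₀).add
      (tendsto_finsetSum Finset.univ fun j _ => (hlam j).smul (h.tendsto_g hx j))
    rw [add_zero] at hlim
    exact tendsto_nhds_unique hlim
      (tendsto_const_nhds.congr fun k => (h.run.multiplier k).stationary.symm)
  · exact le_of_tendsto (h.tendsto_f hx j) (h.eventually_f_nonpos.mono fun k hk => hk j)
  · exact ge_of_tendsto' (hlam j) fun k => (h.run.multiplier k).nonneg j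
  · exact tendsto_nhds_unique ((hlam j).mul (h.tendsto_fbar_add_inner hx j))
      (tendsto_const_nhds.congr fun k => ((h.run.multiplier k).complementary j).symm)

theorem eventually_lam_eq_zero {j : Fin m} (hj : P.f j xstar < 0) : ∀ᶠ k in l, lam k j = 0 := by
  filter_upwards [(h.tendsto_fbar_add_inner hx j).eventually_lt_const hj] with k hk
  exact (mul_eq_zero.1 ((h.run.multiplier k).complementary j)).resolve_right hk.ne

theorem abs_fbar_mul_lam_sub_isLittleO (hmu : P.IsKKTPair xstar mu) (j : Fin m) :
    (fun k => |P.fbar j (x k)| * |lam k j - mu j|) =o[l] fun k => lam k - mu := by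
  rcases (hmu.feasible j).eq_or_lt with hj | hj
  · have hfbar : (fun k => |P.fbar j (x k)|) =o[l] fun _ => (1 : ℝ) :=
      (isLittleO_one_iff ℝ).2 (by simpa [hj] using (h.tendsto_fbar hx j).abs)
    have hlam : (fun k => |lam k j - mu j|) =O[l] fun k => ‖lam k - mu‖ :=
      .of_norm_le fun k => by simpa using norm_le_pi_norm (lam k - mu) j
    simpa using (hfbar.mul_isBigO hlam).norm_right
  · refine (isLittleO_zero _ l).congr' ?_ .rfl
    filter_upwards [h.eventually_lam_eq_zero hx hj] with k hk
    have hmuj : mu j = 0 := (mul_eq_zero.1 (hmu.complementary j)).resolve_right hj.ne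
    simp [hk, hmuj]

theorem lam_sub_isBigO (hmu : P.IsKKTPair xstar mu) :
    (fun k => lam k - mu) =O[l] fun k => ∑ j, (lam k j - mu j) • P.g j (x k) := by
  have hsum : (fun k => ∑ j, |P.fbar j (x k)| * |lam k j - mu j|) =o[l] fun k => lam k - mu :=
    .fun_sum fun j _ => h.abs_fbar_mul_lam_sub_isLittleO hx hmu j
  refine .of_bound (2 * M) ?_
  have hM : 0 < M := zero_lt_one.trans_le (h.bounds 0).one_le
  filter_upwards [hsum.def (by positivity : 0 < (2 * M)⁻¹)] with k hk
  rw [Real.norm_of_nonneg (by positivity), le_inv_mul_iff₀ (by positivity)] at hk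
  have hind := (h.bounds k).independent (lam k - mu)
  simp only [Pi.sub_apply] at hind
  linarith

theorem tendsto_lam (hmu : P.IsKKTPair xstar mu) : Tendsto lam l (𝓝 mu) := by
  refine tendsto_sub_nhds_zero_iff.1 ((h.lam_sub_isBigO hx hmu).trans_tendsto ?_)
  simp only [(h.run.multiplier _).sum_sub_smul_g_eq mu]
  have hlim := ((h.tendsto_g₀ hx).add (tendsto_finsetSum Finset.univ fun j _ =>
    (h.tendsto_g hx j).const_smul (mu j))).add h.tendsto_act_d₀
  simpa [hmu.stationary] using hlim.neg

theorem eventually_fbar_add_inner_eq_zero (hmu : P.IsKKTPair xstar mu) {j : Fin m}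
    (hj : 0 < mu j) : ∀ᶠ k in l, P.fbar j (x k) + ⟪P.g j (x k), d₀ k⟫_ℝ = 0 := by
  filter_upwards [(tendsto_pi_nhds.1 (h.tendsto_lam hx hmu) j).eventually_const_lt hj] with k hk
  exact (mul_eq_zero.1 ((h.run.multiplier k).complementary j)).resolve_left hk.ne'

end RegularRun

namespace RegularRun

variable (h : P.RegularRun p x B d₀ lam d₁ a M L l) (hx : Tendsto x l (𝓝 xstar))
  (hmu : P.IsKKTPair xstar mu)
  (hhess : (fun k => hess (P.lagrangian mu) xstar (d₀ k) - act (B k) (d₀ k)) =o[l] d₀)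
include h hx hmu

theorem inner_g_isLittleO {j : Fin m} (hj : 0 < mu j) :
    (fun k => ⟪P.g j xstar, x k - xstar + d₀ k⟫_ℝ)
      =o[l] fun k => ‖x k - xstar‖ + ‖d₀ k‖ := by
  have hdiff : (fun k => P.f j (x k) - P.f j xstar - ⟪P.g j xstar, x k - xstar⟫_ℝ)
      =o[l] fun k => x k - xstar :=
    (hasGradientAt_iff_isLittleO.1
      ((h.contDiff j).differentiable two_ne_zero xstar).hasGradientAt).comp_tendsto hx
  have hg : (fun k => ⟪P.g j (x k) - P.g j xstar, d₀ k⟫_ℝ) =o[l] d₀ := by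
    have hsub := (isLittleO_one_iff ℝ).2 (tendsto_sub_nhds_zero_iff.2 (h.tendsto_g hx j))
    simpa [real_inner_comm] using inner_isLittleO (isBigO_refl d₀ l).norm_right hsub
  have hzero : P.f j xstar = 0 := (mul_eq_zero.1 (hmu.complementary j)).resolve_left hj.ne'
  refine ((hdiff.trans_isBigO (.of_norm_le fun _ => ?_)).add
    (hg.trans_isBigO (.of_norm_le fun _ => ?_))).neg_left.congr' ?_ .rfl
  · exact le_add_of_nonneg_right (norm_nonneg _)
  · exact le_add_of_nonneg_left (norm_nonneg _)
  filter_upwards [h.eventually_fbar_add_inner_eq_zero hx hmu hj, h.eventually_f_nonpos] with k hk hf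
  rw [fbar_of_nonpos (hf j)] at hk
  simp only [hzero, inner_sub_left, inner_add_right]
  linarith

theorem eventually_neg_lam_sub_mul_inner_le (j : Fin m) :
    ∀ᶠ k in l, -((lam k j - mu j) * ⟪P.g j (x k), x k - xstar + d₀ k⟫_ℝ)
      ≤ ‖lam k - mu‖ * (L * ‖x k - xstar‖ ^ 2) := by
  rcases (hmu.feasible j).eq_or_lt with hj | hj
  · have hM : 0 < M := zero_lt_one.trans_le (h.bounds 0).one_le
    filter_upwards [hx.eventually (Metric.ball_mem_nhds xstar (by positivity : 0 < 2 * M ^ 2)),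
      h.eventually_f_nonpos] with k hk hf
    have htaylor : |P.f j (x k + (xstar - x k)) - P.f j (x k) - ⟪P.g j (x k), xstar - x k⟫_ℝ|
        ≤ L * ‖xstar - x k‖ ^ 2 :=
      abs_sub_sub_inner_gradient_le ((h.contDiff j).differentiable two_ne_zero)
        (convex_closedBall (x k) _) ((h.bounds k).lipschitz_f j)
        (Metric.mem_closedBall_self (by positivity)) (by simpa [dist_comm] using hk.le)
    have hcompl := (h.run.multiplier k).complementary j
    have hslack := mul_nonpos_of_nonneg_of_nonpos (hmu.nonneg j) ((h.run.qp k).1 j)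
    rw [add_sub_cancel, hj, norm_sub_rev, ← neg_sub (x k), inner_neg_right] at htaylor
    rw [fbar_of_nonpos (hf j)] at hcompl hslack
    have hmul := mul_le_mul (norm_le_pi_norm (lam k - mu) j) htaylor (abs_nonneg _) (norm_nonneg _)
    rw [Pi.sub_apply, Real.norm_eq_abs, ← abs_mul] at hmul
    rw [inner_add_right]
    linarith [neg_abs_le
      ((lam k j - mu j) * (0 - P.f j (x k) - -⟪P.g j (x k), x k - xstar⟫_ℝ))]
  · filter_upwards [h.eventually_lam_eq_zero hx hj] with k hk
    have hmuj : mu j = 0 := (mul_eq_zero.1 (hmu.complementary j)).resolve_right hj.ne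
    simp only [hk, hmuj, sub_zero, zero_mul, neg_zero]
    positivity

include hhess

theorem hess_add_sum_isLittleO :
    (fun k => hess (P.lagrangian mu) xstar (x k - xstar + d₀ k)
      + ∑ j, (lam k j - mu j) • P.g j (x k)) =o[l] fun k => ‖x k - xstar‖ + ‖d₀ k‖ := by
  have hgrad : (fun k => ∇ (P.lagrangian mu) (x k) - ∇ (P.lagrangian mu) xstar
      - hess (P.lagrangian mu) xstar (x k - xstar)) =o[l] fun k => x k - xstar :=
    gradient_sub_isLittleO (contDiff_lagrangian h.contDiff₀ h.contDiff mu) tendsto_const_nhds hx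
  refine ((hhess.trans_isBigO (.of_norm_le fun _ => ?_)).sub
    (hgrad.trans_isBigO (.of_norm_le fun _ => ?_))).congr_left fun k => ?_
  · exact le_add_of_nonneg_left (norm_nonneg _)
  · exact le_add_of_nonneg_right (norm_nonneg _)
  · simp only [gradient_lagrangian (h.contDiff₀.differentiable two_ne_zero)
      fun j => (h.contDiff j).differentiable two_ne_zero]
    rw [hmu.stationary, (h.run.multiplier k).sum_sub_smul_g_eq, map_add]
    abel

theorem norm_lam_sub_mul_sq_isLittleO :
    (fun k => ‖lam k - mu‖ * (L * ‖x k - xstar‖ ^ 2))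
      =o[l] fun k => (‖x k - xstar‖ + ‖d₀ k‖) ^ 2 := by
  set N := fun k => ‖x k - xstar‖ + ‖d₀ k‖
  have hsum : (fun k => ∑ j, (lam k j - mu j) • P.g j (x k)) =O[l] N := by
    have hw : (fun k => x k - xstar + d₀ k) =O[l] N := .of_norm_le fun k => norm_add_le _ _
    simpa only [add_sub_cancel_left] using (h.hess_add_sum_isLittleO hx hmu hhess).isBigO.sub
      (((hess (P.lagrangian mu) xstar).isBigO_comp _ l).trans hw)
  have hu : (fun k => ‖x k - xstar‖ ^ 2) =o[l] N := by
    have hzero := (isLittleO_one_iff ℝ).2 (tendsto_sub_nhds_zero_iff.2 hx)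
    have hN : (fun k => x k - xstar) =O[l] N :=
      .of_norm_le fun _ => le_add_of_nonneg_right (norm_nonneg _)
    simpa [sq] using hzero.norm_left.mul_isBigO hN.norm_left
  exact (((h.lam_sub_isBigO hx hmu).trans hsum).norm_left.mul_isLittleO
    (hu.const_mul_left L)).congr_right fun k => (sq (N k)).symm

theorem full_step_isLittleO (hsosc : P.SSOSC xstar mu) :
    (fun k => x k - xstar + d₀ k) =o[l] fun k => ‖x k - xstar‖ + ‖d₀ k‖ := by
  let w := fun k => x k - xstar + d₀ k
  let N := fun k => ‖x k - xstar‖ + ‖d₀ k‖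
  let v : Fin m → E n := fun j => if 0 < mu j then P.g j xstar else 0
  let S := fun k => ∑ j, (lam k j - mu j) • P.g j (x k)
  obtain ⟨c, hc, C, hcoercive⟩ := exists_coercive_add_mul_sum_inner_sq
    (hess (P.lagrangian mu) xstar) v
    fun d hd hv => hsosc d hd fun j hj => by simpa [v, hj] using hv j
  have hv : ∀ j, (fun k => ⟪v j, w k⟫_ℝ ^ 2) =o[l] fun k => N k ^ 2 := fun j => by
    by_cases hj : 0 < mu j
    · simpa only [v, if_pos hj] using (h.inner_g_isLittleO hx hmu hj).pow two_pos
    · simp [v, hj]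
  have hinner : (fun k => ⟪w k, hess (P.lagrangian mu) xstar (w k) + S k⟫_ℝ)
      =o[l] fun k => N k ^ 2 := by
    have hwN : w =O[l] N := .of_norm_le fun k => norm_add_le _ _
    simpa only [sq] using inner_isLittleO hwN (h.hess_add_sum_isLittleO hx hmu hhess)
  have hlittle := (hinner.add (.fun_sum fun (_ : Fin m) (_ : _ ∈ Finset.univ) =>
    h.norm_lam_sub_mul_sq_isLittleO hx hmu hhess)).add
      ((IsLittleO.fun_sum fun j (_ : j ∈ Finset.univ) => hv j).const_mul_left C)
  suffices hsq : (fun k => ‖w k‖ ^ 2) =o[l] fun k => N k ^ 2 from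
    (hsq.of_pow two_ne_zero).of_norm_left
  refine IsBigO.trans_isLittleO (.of_bound c⁻¹ ?_) hlittle
  filter_upwards [eventually_all.2 (h.eventually_neg_lam_sub_mul_inner_le hx hmu)] with k hk
  have hS : -⟪w k, S k⟫_ℝ ≤ ∑ _j : Fin m, ‖lam k - mu‖ * (L * ‖x k - xstar‖ ^ 2) := by
    simp only [S, inner_sum, inner_smul_right, real_inner_comm, ← Finset.sum_neg_distrib]
    exact Finset.sum_le_sum fun j _ => hk j
  rw [Real.norm_of_nonneg (by positivity), le_inv_mul_iff₀ hc]
  refine le_trans ?_ (Real.le_norm_self _)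
  rw [inner_add_right]
  linarith [hcoercive (w k)]

end RegularRun

/-- The remainder `h(x + d) - h(x) - ∇h(x)ᵀd` of the first-order Taylor expansion of `h` at `x`. -/
def taylorRemainder (h : E n → ℝ) (x d : E n) : ℝ := h (x + d) - h x - ⟪∇ h x, d⟫_ℝ

theorem taylorRemainder_lagrangian (hf₀ : Differentiable ℝ P.f₀)
    (hf : ∀ j, Differentiable ℝ (P.f j)) (mu : Fin m → ℝ) (x d : E n) :
    taylorRemainder (P.lagrangian mu) x d
      = taylorRemainder P.f₀ x d + ∑ j, mu j * taylorRemainder (P.f j) x d := by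
  rw [taylorRemainder, gradient_lagrangian hf₀ hf]
  simp only [taylorRemainder, lagrangian, g₀, g, inner_add_left, sum_inner,
    real_inner_smul_left, mul_sub, Finset.sum_sub_distrib]
  ring

theorem IsQPMultiplier.mul_diag {x d : E n} {B : Matrix (Fin n) (Fin n) ℝ} {lam : Fin m → ℝ}
    (h : P.IsQPMultiplier x B d lam) (j : Fin m) :
    lam j * P.diag x d j = lam j * |P.fbar j x| * ‖d‖ := by
  rcases mul_eq_zero.1 (h.complementary j) with hj | hj
  · simp [hj]
  · rw [diag, hj, abs_zero, zero_add, mul_assoc]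

theorem SolvesSLE.f_add_inner_eq {x d₀ d : E n} {B : Matrix (Fin n) (Fin n) ℝ} {h : Fin m → ℝ}
    (hs : P.SolvesSLE x B d₀ (P.rhsCorr p x d₀) d h) (hp : p.Admissible) (hφ : P.phi x = 0)
    (j : Fin m) : P.f j (x + d₀) + ⟪P.g j x, d⟫_ℝ
      = P.fbar j x + ⟪P.g j x, d₀⟫_ℝ + P.diag x d₀ j * h j - ‖d₀‖ ^ p.τ := by
  have hrow := hs.2 j
  rw [rhsCorr, hφ, Real.zero_rpow (hp.θ_pos.trans hp.θ_lt).ne'] at hrow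
  rw [fbar_of_nonpos (phi_eq_zero_iff.1 hφ j)]
  linarith

namespace RegularRun

variable (h : P.RegularRun p x B d₀ lam d₁ a M L l)
include h

theorem f_taylorRemainder_isBigO (j : Fin m) :
    (fun k => taylorRemainder (P.f j) (x k) (d₀ k)) =O[l] fun k => ‖d₀ k‖ ^ 2 := by
  refine .of_bound L (.of_forall fun k => ?_)
  have hd₀ := (h.bounds k).d₀_le
  have hM := (h.bounds k).one_le
  rw [norm_pow, norm_norm]
  refine abs_sub_sub_inner_gradient_le ((h.contDiff j).differentiable two_ne_zero)
    (convex_closedBall (x k) _) ((h.bounds k).lipschitz_f j)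
    (Metric.mem_closedBall_self (by positivity)) (d := d₀ k) ?_
  rw [mem_closedBall_iff_norm, add_sub_cancel_left]
  nlinarith

theorem norm_d₀_rpow_τ_isLittleO : (fun k => ‖d₀ k‖ ^ p.τ) =o[l] fun k => ‖d₀ k‖ ^ 2 := by
  simpa using norm_rpow_isLittleO h.tendsto_d₀ zero_le_two h.admissible.τ_mem.1

theorem norm_d₀_pow_three_isLittleO : (fun k => ‖d₀ k‖ ^ 3) =o[l] fun k => ‖d₀ k‖ ^ 2 := by
  simpa using norm_rpow_isLittleO h.tendsto_d₀ zero_le_two (by norm_num : (2 : ℝ) < 3)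

theorem rhsCorr_isBigO : (fun k => P.rhsCorr p (x k) (d₀ k)) =O[l] fun k => ‖d₀ k‖ ^ 2 := by
  refine isBigO_pi.2 fun j => ((h.norm_d₀_rpow_τ_isLittleO.isBigO.neg_left).sub
    (h.f_taylorRemainder_isBigO j)).congr' ?_ .rfl
  filter_upwards [h.feasible] with k hk
  rw [rhsCorr, hk, Real.zero_rpow (h.admissible.θ_pos.trans h.admissible.θ_lt).ne', add_zero]
  rfl

theorem d₁_isBigO : d₁ =O[l] fun k => ‖d₀ k‖ ^ 2 := by
  refine (IsBigO.of_bound M (.of_forall fun k => ?_)).trans h.rhsCorr_isBigO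
  obtain ⟨h₁, hs⟩ := h.run.correction k
  exact ((h.bounds k).sle hs).1

theorem exists_solvesSLE_isBigO : ∃ h₁ : ℕ → Fin m → ℝ,
    (∀ k, P.SolvesSLE (x k) (B k) (d₀ k) (P.rhsCorr p (x k) (d₀ k)) (d₁ k) (h₁ k)) ∧
      h₁ =O[l] fun k => ‖d₀ k‖ ^ 2 := by
  choose h₁ hs using h.run.correction
  exact ⟨h₁, hs, (IsBigO.of_bound M (.of_forall fun k => ((h.bounds k).sle (hs k)).2)).trans
    h.rhsCorr_isBigO⟩

theorem d₁_isLittleO : d₁ =o[l] d₀ := by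
  refine h.d₁_isBigO.trans_isLittleO (IsLittleO.of_norm_right ?_)
  simpa using norm_rpow_isLittleO h.tendsto_d₀ zero_le_one one_lt_two

theorem step_isBigO : (fun k => x (k + 1) - x k) =O[l] d₀ := by
  refine .trans (.of_bound' ?_) (((isBigO_refl d₀ l).add h.d₁_isLittleO.isBigO).norm_left.add
    ((isBigO_refl d₀ l).norm_left.const_mul_left M))
  filter_upwards [h.feasible] with k hφ
  refine le_trans ?_ (Real.le_norm_self _)
  have hM := (h.bounds k).one_le
  rcases h.run.update k with ⟨-, i, -, -, -, hx⟩ | ⟨-, dt, ht, hs, i, -, -, hx⟩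
  · have ht : ((1 : ℝ) / 2) ^ i ≤ 1 := pow_le_one₀ (by norm_num) (by norm_num)
    rw [hx, add_sub_cancel_left, norm_smul, Real.norm_of_nonneg (by positivity)]
    exact (mul_le_of_le_one_left (norm_nonneg _) ht).trans
      (le_add_of_nonneg_right (by positivity))
  · obtain ⟨hη₀, hη₁⟩ := h.admissible.η_mem
    have hq := (h.bounds k).norm_q_le h.admissible hs
    rw [hφ, Real.zero_rpow (h.admissible.θ_pos.trans h.admissible.θ_lt).ne', mul_zero,
      add_zero] at hq
    rw [hx, add_sub_cancel_left, norm_smul, Real.norm_of_nonneg (by positivity)]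
    exact (mul_le_of_le_one_left (norm_nonneg _) (pow_le_one₀ hη₀.le hη₁.le)).trans
      (hq.trans (le_add_of_nonneg_left (norm_nonneg _)))

theorem correction_remainder_isBigO {f : E n → ℝ} (hf : Differentiable ℝ f)
    (hL : ∀ k, LipschitzOnWith L (∇ f) (Metric.closedBall (x k) (2 * M ^ 2))) :
    (fun k => f (x k + (d₀ k + d₁ k)) - f (x k + d₀ k) - ⟪∇ f (x k), d₁ k⟫_ℝ)
      =O[l] fun k => ‖d₀ k‖ ^ 3 := by
  have hprod : (fun k => L * (‖d₀ k‖ + ‖d₁ k‖) * ‖d₁ k‖) =O[l] fun k => ‖d₀ k‖ * ‖d₀ k‖ ^ 2 :=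
    ((((isBigO_refl d₀ l).norm_norm.add h.d₁_isLittleO.isBigO.norm_norm).const_mul_left L).mul
      h.d₁_isBigO.norm_left)
  refine .trans (.of_bound' ?_) (hprod.congr_right fun k => by ring)
  filter_upwards [h.d₁_isLittleO.def one_pos] with k hd₁
  refine le_trans ?_ (Real.le_norm_self _)
  have hd₀ := (h.bounds k).d₀_le
  have hM := (h.bounds k).one_le
  refine abs_sub_add_sub_inner_gradient_le hf (convex_closedBall (x k) _) (hL k)
    (Metric.mem_closedBall_self (by positivity)) ?_ ?_
  · rw [mem_closedBall_iff_norm, add_sub_cancel_left]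
    nlinarith
  · rw [mem_closedBall_iff_norm, add_sub_cancel_left]
    nlinarith [norm_add_le (d₀ k) (d₁ k)]

theorem eventually_directionTest :
    ∀ᶠ k in l, P.DirectionTest p (x k) (d₀ k) (d₀ k + d₁ k) := by
  have hδ := h.admissible.δ_gt
  have hd₀ : (fun k => ‖d₀ k‖ ^ p.δ) =o[l] fun k => ‖d₀ k‖ ^ 2 := by
    simpa using norm_rpow_isLittleO h.tendsto_d₀ zero_le_two hδ
  have hd : (fun k => ‖d₀ k + d₁ k‖ ^ p.δ) =o[l] fun k => ‖d₀ k‖ ^ 2 :=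
    (((isBigO_refl d₀ l).add h.d₁_isLittleO.isBigO).norm_norm.rpow (by linarith)
      (.of_forall fun k => norm_nonneg _)).trans_isLittleO hd₀
  have ha := (h.bounds 0).a_pos
  have hζ := h.admissible.ζ_pos
  filter_upwards [h.feasible, (hd₀.const_mul_left p.ζ).def ha, (hd.const_mul_left p.ζ).def ha]
    with k hφ hk₀ hk
  rw [Real.norm_of_nonneg (by positivity), Real.norm_of_nonneg (by positivity)] at hk₀ hk
  rw [DirectionTest, hφ, Real.zero_rpow h.admissible.ϱ_pos.ne', mul_zero, add_zero,
    mul_min_of_nonneg _ _ hζ.le]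
  have hdescent := (h.bounds k).descent
  exact le_min (by linarith) (by linarith)

theorem abs_fbar_mul_isBigO {h₁ : ℕ → Fin m → ℝ} (hh₁ : h₁ =O[l] fun k => ‖d₀ k‖ ^ 2)
    (j : Fin m) : (fun k => |P.fbar j (x k)| * h₁ k j) =O[l] fun k => ‖d₀ k‖ ^ 2 := by
  have hfbar : (fun k => |P.fbar j (x k)|) =O[l] fun _ => (1 : ℝ) :=
    .of_bound M (.of_forall fun k => by simpa using (h.bounds k).abs_fbar_le j)
  simpa using hfbar.mul (isBigO_pi.1 hh₁ j)

theorem eventually_f_unit_step_nonpos (j : Fin m) :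
    ∀ᶠ k in l, P.f j (x k + (d₀ k + d₁ k)) ≤ 0 := by
  obtain ⟨h₁, hs, hh₁⟩ := h.exists_solvesSLE_isBigO
  have hfh := h.abs_fbar_mul_isBigO hh₁ j
  have hfh_le : ∀ᶠ k in l, |P.fbar j (x k)| * h₁ k j ≤ 1 :=
    (hfh.trans_tendsto (by simpa using h.tendsto_d₀.norm.pow 2)).eventually_le_const one_pos
  have hfhd : (fun k => |P.fbar j (x k)| * h₁ k j * ‖d₀ k‖) =O[l] fun k => ‖d₀ k‖ ^ 3 :=
    (hfh.mul (isBigO_refl _ l)).congr_right fun k => by ring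
  have hcubic : (fun k => ‖d₀ k‖ ^ 3) =o[l] fun k => ‖d₀ k‖ ^ p.τ := by
    simpa using norm_rpow_isLittleO h.tendsto_d₀ (zero_le_two.trans h.admissible.τ_mem.1.le)
      h.admissible.τ_mem.2
  have hrest := ((h.correction_remainder_isBigO ((h.contDiff j).differentiable two_ne_zero)
    fun k => (h.bounds k).lipschitz_f j).add hfhd).trans_isLittleO hcubic
  filter_upwards [h.feasible, hfh_le, hrest.def one_pos] with k hφ hk hrest
  have hslack := (h.run.qp k).1 j
  have hrow := (hs k).f_add_inner_eq h.admissible hφ j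
  rw [diag, abs_of_nonpos hslack] at hrow
  have hrest' := (Real.le_norm_self _).trans hrest
  rw [one_mul, Real.norm_of_nonneg (by positivity)] at hrest'
  have hmul := mul_nonpos_of_nonpos_of_nonneg hslack (sub_nonneg.2 hk)
  change _ - _ - ⟪P.g j (x k), d₁ k⟫_ℝ + _ ≤ _ at hrest'
  linarith

end RegularRun

namespace RegularRun

section

variable (h : P.RegularRun p x B d₀ lam d₁ a M L l)
include h

theorem act_d₀_inner_d₁_isLittleO :
    (fun k => ⟪act (B k) (d₀ k), d₁ k⟫_ℝ) =o[l] fun k => ‖d₀ k‖ ^ 2 := by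
  simpa only [sq] using inner_isLittleO h.act_d₀_isBigO.norm_right h.d₁_isLittleO.norm_right

theorem lam_isBigO_one (j : Fin m) : (fun k => lam k j) =O[l] fun _ => (1 : ℝ) :=
  .of_bound M (.of_forall fun k => by
    simpa using (norm_le_pi_norm (lam k) j).trans (h.bounds k).lam_le)

theorem taylorRemainder_lagrangian_sub_isLittleO (hx : Tendsto x l (𝓝 xstar))
    (hhess : (fun k => hess (P.lagrangian mu) xstar (d₀ k) - act (B k) (d₀ k)) =o[l] d₀) :
    (fun k => taylorRemainder (P.lagrangian mu) (x k) (d₀ k)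
      - 1 / 2 * ⟪d₀ k, act (B k) (d₀ k)⟫_ℝ) =o[l] fun k => ‖d₀ k‖ ^ 2 := by
  have hinner : (fun k => ⟪d₀ k, hess (P.lagrangian mu) xstar (d₀ k) - act (B k) (d₀ k)⟫_ℝ)
      =o[l] fun k => ‖d₀ k‖ ^ 2 := by
    simpa only [sq] using inner_isLittleO (isBigO_refl d₀ l).norm_right hhess.norm_right
  refine ((taylor_two_isLittleO (contDiff_lagrangian h.contDiff₀ h.contDiff mu) hx
    h.tendsto_d₀).add (hinner.const_mul_left (1 / 2))).congr_left fun k => ?_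
  rw [inner_sub_right, taylorRemainder, hess]
  ring

end

variable (h : P.RegularRun p x B d₀ lam d₁ a M L l) (hx : Tendsto x l (𝓝 xstar))
  (hmu : P.IsKKTPair xstar mu)
  (hhess : (fun k => hess (P.lagrangian mu) xstar (d₀ k) - act (B k) (d₀ k)) =o[l] d₀)
include h hx hmu

theorem lam_mul_inner_g_add_isLittleO (j : Fin m) :
    (fun k => lam k j * ⟪P.g j (x k), d₁ k⟫_ℝ
      + mu j * taylorRemainder (P.f j) (x k) (d₀ k)) =o[l] fun k => ‖d₀ k‖ ^ 2 := by
  obtain ⟨h₁, hs, hh₁⟩ := h.exists_solvesSLE_isBigO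
  have hdiag : (fun k => lam k j * (|P.fbar j (x k)| * h₁ k j * ‖d₀ k‖))
      =o[l] fun k => ‖d₀ k‖ ^ 2 := by
    have hprod := (h.lam_isBigO_one j).mul
      ((h.abs_fbar_mul_isBigO hh₁ j).mul (isBigO_refl (fun k => ‖d₀ k‖) l))
    exact (hprod.congr_right fun k => by ring).trans_isLittleO h.norm_d₀_pow_three_isLittleO
  have hτ : (fun k => lam k j * ‖d₀ k‖ ^ p.τ) =o[l] fun k => ‖d₀ k‖ ^ 2 := by
    simpa using (h.lam_isBigO_one j).mul_isLittleO h.norm_d₀_rpow_τ_isLittleO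
  have hlam : (fun k => (lam k j - mu j) * taylorRemainder (P.f j) (x k) (d₀ k))
      =o[l] fun k => ‖d₀ k‖ ^ 2 := by
    have hzero := (isLittleO_one_iff ℝ).2
      (tendsto_sub_nhds_zero_iff.2 (tendsto_pi_nhds.1 (h.tendsto_lam hx hmu) j))
    simpa using hzero.mul_isBigO (h.f_taylorRemainder_isBigO j)
  refine ((hdiag.sub hτ).sub hlam).congr' ?_ .rfl
  filter_upwards [h.feasible] with k hφ
  have hrow := (hs k).2 j
  rw [rhsCorr, hφ, Real.zero_rpow (h.admissible.θ_pos.trans h.admissible.θ_lt).ne'] at hrow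
  change _ = -(_ + 0) - taylorRemainder (P.f j) (x k) (d₀ k) at hrow
  linear_combination -lam k j * hrow - h₁ k j * (h.run.multiplier k).mul_diag j

theorem inner_g₀_sub_sum_isLittleO :
    (fun k => ⟪P.g₀ (x k), d₁ k⟫_ℝ - ∑ j, mu j * taylorRemainder (P.f j) (x k) (d₀ k))
      =o[l] fun k => ‖d₀ k‖ ^ 2 := by
  refine (h.act_d₀_inner_d₁_isLittleO.add (.fun_sum fun j (_ : j ∈ Finset.univ) =>
    h.lam_mul_inner_g_add_isLittleO hx hmu j)).neg_left.congr_left fun k => ?_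
  have hstat := congrArg (fun v => ⟪v, d₁ k⟫_ℝ) (h.run.multiplier k).stationary
  simp only [inner_add_left, sum_inner, real_inner_smul_left, inner_zero_left] at hstat
  rw [Finset.sum_add_distrib]
  linarith

include hhess

theorem f₀_unit_step_isLittleO :
    (fun k => P.f₀ (x k + (d₀ k + d₁ k)) - P.f₀ (x k) - ⟪P.g₀ (x k), d₀ k⟫_ℝ
      - 1 / 2 * ⟪d₀ k, act (B k) (d₀ k)⟫_ℝ) =o[l] fun k => ‖d₀ k‖ ^ 2 := by
  have hdiff₀ := h.contDiff₀.differentiable two_ne_zero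
  have hdiff := fun j => (h.contDiff j).differentiable two_ne_zero
  refine ((((h.correction_remainder_isBigO hdiff₀
    fun k => (h.bounds k).lipschitz_f₀).trans_isLittleO h.norm_d₀_pow_three_isLittleO).add
    (h.inner_g₀_sub_sum_isLittleO hx hmu)).add
    (h.taylorRemainder_lagrangian_sub_isLittleO hx hhess)).congr_left fun k => ?_
  rw [taylorRemainder_lagrangian hdiff₀ hdiff, taylorRemainder, g₀]
  ring

theorem eventually_f₀_unit_step_le :
    ∀ᶠ k in l, P.f₀ (x k + (d₀ k + d₁ k)) ≤ P.f₀ (x k) + p.α * ⟪P.g₀ (x k), d₀ k⟫_ℝ := by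
  obtain ⟨-, hα⟩ := h.admissible.α_mem
  have hc : 0 < (1 / 2 - p.α) * a := mul_pos (sub_pos.2 hα) (h.bounds 0).a_pos
  filter_upwards [(h.f₀_unit_step_isLittleO hx hmu hhess).def hc] with k hk
  have hcurv : ⟪P.g₀ (x k), d₀ k⟫_ℝ + ⟪d₀ k, act (B k) (d₀ k)⟫_ℝ ≤ 0 := by
    have hsum : 0 ≤ ∑ j, |P.fbar j (x k)| * |lam k j| := by positivity
    linarith [(h.run.multiplier k).inner_add_inner_add_sum_eq_zero]
  have hdescent := mul_le_mul_of_nonneg_left (h.bounds k).descent (sub_pos.2 hα).le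
  replace hk := (Real.le_norm_self _).trans hk
  rw [Real.norm_of_nonneg (by positivity)] at hk
  linarith

theorem eventually_unit_step : ∀ᶠ k in l, x (k + 1) = x k + (d₀ k + d₁ k) := by
  filter_upwards [h.feasible, h.eventually_directionTest,
    eventually_all.2 h.eventually_f_unit_step_nonpos, h.eventually_f₀_unit_step_le hx hmu hhess]
    with k hφ hdir hfeas hdec
  have hacc : P.AcceptI p (x k) (d₀ k) (d₀ k + d₁ k) ((1 / 2) ^ 0) := by
    rw [pow_zero]
    refine ⟨?_, fun j hj => absurd hj (phi_eq_zero_iff.1 hφ j).not_gt, fun j _ => ?_⟩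
    · rwa [hφ, Real.zero_rpow h.admissible.θ_pos.ne', mul_zero, add_zero, mul_one, one_smul]
    · rw [one_smul]
      exact hfeas j
  rcases h.run.update k with ⟨-, i, -, -, hrej, hx⟩ | ⟨hno, -⟩
  · obtain rfl : i = 0 := Nat.eq_zero_of_not_pos fun hi => hrej 0 hi hacc
    simpa using hx
  · exact absurd ⟨hdir, 0, by simpa using h.admissible.ε_mem.2.le, hacc⟩ hno

theorem superlinear (hsosc : P.SSOSC xstar mu) :
    (fun k => x (k + 1) - xstar) =o[l] fun k => x k - xstar := by
  have hfull := h.full_step_isLittleO hx hmu hhess hsosc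
  have hd₀ : d₀ =O[l] fun k => x k - xstar :=
    isBigO_of_add_isLittleO (by simpa only [add_comm] using hfull)
  have hN : (fun k => ‖x k - xstar‖ + ‖d₀ k‖) =O[l] fun k => x k - xstar :=
    (isBigO_refl _ l).norm_left.add hd₀.norm_left
  refine ((hfull.trans_isBigO hN).add (h.d₁_isLittleO.trans_isBigO hd₀)).congr' ?_ .rfl
  filter_upwards [h.eventually_unit_step hx hmu hhess] with k hk
  rw [hk]
  abel

end RegularRun

theorem RegularRun.tendsto (h : P.RegularRun p x B d₀ lam d₁ a M L atTop)
    (hacc : MapClusterPt xstar atTop x)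
    (hfull : (fun k => x k - xstar + d₀ k)
      =o[atTop ⊓ comap x (𝓝 xstar)] fun k => ‖x k - xstar‖ + ‖d₀ k‖) :
    Tendsto x atTop (𝓝 xstar) := by
  obtain ⟨C, hC⟩ := (isBigO_of_add_isLittleO hfull).bound
  obtain ⟨D, hD⟩ := h.step_isBigO.bound
  refine tendsto_of_mapClusterPt (ε := fun k => max C D * ‖d₀ k‖)
    (by simpa using h.tendsto_d₀.norm.const_mul (max C D)) hacc
    (hC.mono fun k hk => ?_) (hD.mono fun k hk => ?_)
  · exact (dist_eq_norm _ _).trans_le (hk.trans (by gcongr; exact le_max_left _ _))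
  · exact (dist_eq_norm _ _).trans_le (hk.trans (by gcongr; exact le_max_right _ _))

theorem exists_regularRun (hp : p.Admissible) (hrun : P.IsRun p x B d₀ lam d₁)
    (hindep : P.GradientsIndependent) (hB : UniformlyPosDef B) (hf₀ : ContDiff ℝ 2 P.f₀)
    (hf : ∀ j, ContDiff ℝ 2 (P.f j)) (hbdd : Bornology.IsBounded (Set.range x)) :
    ∃ a M L, P.RegularRun p x B d₀ lam d₁ a M L atTop := by
  obtain ⟨a, M, L, hb⟩ := exists_iterateBounds hrun hindep hB hf₀ hf hbdd
  obtain ⟨κ, hκ, hprogress⟩ := exists_progress hrun hp hb (hf₀.differentiable two_ne_zero)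
    fun j => (hf j).differentiable two_ne_zero
  have hfeas := eventually_phi_eq_zero_of_progress hp hκ hprogress
  exact ⟨a, M, L, hf₀, hf, hp, hrun, hb, hfeas,
    tendsto_d₀_of_progress hκ hprogress hfeas hf₀.continuous hbdd⟩

end LocalConvergence

end Problem

end

end NCP

theorem theorem5 {n m : ℕ} (P : NCP.Problem n m) (p : NCP.Params) (hp : p.Admissible)
    (x : ℕ → NCP.E n) (B : ℕ → Matrix (Fin n) (Fin n) ℝ) (d₀ : ℕ → NCP.E n)
    (lam : ℕ → Fin m → ℝ) (d₁ : ℕ → NCP.E n)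
    (hrun : P.IsRun p x B d₀ lam d₁)
    (hindep : P.GradientsIndependent)
    (hB : NCP.UniformlyPosDef B)
    (hf₀ : ContDiff ℝ 2 P.f₀) (hf : ∀ j, ContDiff ℝ 2 (P.f j))
    (hbdd : Bornology.IsBounded (Set.range x))
    (xstar : NCP.E n) (hacc : MapClusterPt xstar atTop x)
    (hssosc : ∀ lamstar : Fin m → ℝ, P.IsKKTPair xstar lamstar → P.SSOSC xstar lamstar)
    (hhess : ∀ lamstar : Fin m → ℝ, P.IsKKTPair xstar lamstar →
      (fun k => NCP.hess (P.lagrangian lamstar) xstar (d₀ k) - NCP.act (B k) (d₀ k))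
        =o[atTop] d₀) :
    (∃ lamstar : Fin m → ℝ, P.IsKKTPair xstar lamstar) ∧
      Tendsto x atTop (𝓝 xstar) ∧
      (fun k => x (k + 1) - xstar) =o[atTop] (fun k => x k - xstar) := by
  obtain ⟨a, M, L, h⟩ := NCP.Problem.exists_regularRun hp hrun hindep hB hf₀ hf hbdd
  have : (atTop ⊓ comap x (𝓝 xstar)).NeBot := by
    rwa [neBot_inf_comap_iff_map, inf_comm]
  have hx : Tendsto x (atTop ⊓ comap x (𝓝 xstar)) (𝓝 xstar) :=
    tendsto_comap.mono_left inf_le_right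
  obtain ⟨mu, hmu⟩ := (h.mono inf_le_left).exists_isKKTPair hx
  have hfull := (h.mono inf_le_left).full_step_isLittleO hx hmu
    ((hhess mu hmu).mono inf_le_left) (hssosc mu hmu)
  have hlim := h.tendsto hacc hfull
  exact ⟨⟨mu, hmu⟩, hlim, h.superlinear hlim hmu (hhess mu hmu) (hssosc mu hmu)⟩
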